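/- Let $\mathbb F$ be a field, let $a,b\ge 1$ be coprime integers, $d\in\mathbb F\setminus\{0\}$, and let $X$ be the Miura–Kamiya curve $y^a+\sum_{ai+bj<ab}c_{i,j}x^iy^j+dx^b=0$ over $\mathbb F$, with coordinate ring $R=\mathbb F[x,y]$. The monomials $x^iy^j$ ($i\ge 0$, $0\le j<a$) form an $\mathbb F$-basis of $R$. For $0\ne f\in R$ let $\delta(f)$ be the largest $ai+bj$ such that $x^iy^j$ ($j<a$) occurs in $f$ (the pole order of $f$ at the point at infinity), and put $\delta(0)=-\infty$. Let $S=\{ai+bj\mid i,j\ge 0\}$ (its elements are called nongaps); for $s\in S$ let $\phi_s$ be the unique monomial with $\delta(\phi_s)=s$. Write $\mathrm{lm}(f)=\phi_{\delta(f)}$, and let $\mathrm{lc}(f)$ be the coefficient of $\mathrm{lm}(f)$ in $f$. Say that $\phi_s$ divides $\phi_t$ if $t-s\in S$; the lcms of two monomials are their common multiples that are minimal for divisibility (one or two monomials). For an ideal $I$ of $R$ let $\Delta(I)$ be the set of the monomials that are not of the form $\mathrm{lm}(f)$, $0\neq f\in I$. For a set $T\subset R$ let $\Sigma(T)$ be the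 set of the monomials divisible by $\mathrm{lm}(f)$ for some $0\ne f\in T$, and $\Delta(T)$ its complement in the set of monomials. A Gröbner basis of $I$ is a set of nonzero elements of $I$ such that $\mathrm{lm}(f)$ is divisible by the leading monomial of one of them for every $0\neq f\in I$. Let $P_1,\dots,P_n$ be distinct $\mathbb F$-rational points of the affine curve $X$, let $J=\bigcap_i\mathfrak m_i$ be the intersection of their maximal ideals, and $\mathrm{ev}(f)=(f(P_1),\dots,f(P_n))$ for $f\in R$. Let $u<n$ be a non-negative integer. A message $(\omega_s)_{s\in S,\,s\le u}$ is encoded as $c=\mathrm{ev}(\mu)$ with $\mu=\sum_{s\in S,\,s\le u}\omega_s\phi_s$, and $v=c+e$ with $e\in\mathbb F^n$ is received; $\mathrm{wt}(e)$ is the number of nonzero entries of $e$. Elements of $Rz\oplus R$ are written $f=f^Uz+f^D$. For an integer $s$, the order $>_s$ on the monomials $\phi_tz,\phi_t$ of $Rz\oplus R$ compares the weights $t+s$ of $\phi_tz$ and $t$ of $\phi_t$, and breaks ties in favour of the higher $z$-degree; $\mathrm{lm}_s(f)$ and $\mathrm{lt}_s(f)$ are the leading monomial and the leading term for $>_s$.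 For a finite set $B\subset Rz\oplus R$ of nonzero elements, $G_i$ and $F_j$ denote its elements with $\mathrm{lm}_s$ in $R$ and in $Rz$, respectively. For a monomial $\psi$ of $R$ and $f$ with leading term in $R$ such that the leading monomial of $f$ divides $\psi$, $\psi/\mathrm{lt}(f)$ is the scalar multiple $\lambda$ of a monomial of $R$ such that $\lambda f^D$ has leading term $\psi$. The interpolation decoding algorithm runs as follows. *Initialize:* choose $h\in R$ with $\mathrm{ev}(h)=v$ and a finite Gröbner basis $\{\eta_i\}$ of $J$; let $N=\delta(h)$, $B^{(N)}=\{\eta_i\}\cup\{z-h\}$, and $w^{(s)}=0$ for all $s$. *Main:* for $s=N,N-1,\dots,0$ (no iteration if $h=0$), with $B^{(s)}=\{G_i,F_j\}$: *M1.* If $s\in S$ and $s\le u$, let $w_j=-\kappa_j/\mathrm{lc}(F_j^U\phi_s)$, where $\kappa_j$ is the coefficient of $\mathrm{lm}(F_j^U\phi_s)$ in $F_j^D$; for each $c\in W=\{w_j\}$ let $d_c=\bigl|\bigcup_{w_j=c}\Sigma(\{F_j^U\phi_s\})\cap\Delta(\{G_i^D\})\bigr|$; let $w^{(s)}$ be an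 element $c\in W$ with largest $d_c$; and let $\tilde B=\{f(z+w^{(s)}\phi_s)\mid f\in B^{(s)}\}$. Otherwise let $\tilde B=B^{(s)}$. *M2.* Write $\tilde B=\{\tilde G_i,\tilde F_j\}$. Put $\mathrm{spoly}(\tilde F_j)=\{\tilde F_j\}$ if $\mathrm{lm}_{s-1}(\tilde F_j)\in Rz$. If $\mathrm{lm}_{s-1}(\tilde F_j)\in R$ is divisible by some $\mathrm{lm}_s(\tilde G_i)$, choose one such $i$ and let $\mathrm{spoly}(\tilde F_j)$ consist of the element $\frac{\psi}{\mathrm{lt}_{s-1}(\tilde F_j)}\tilde F_j-\frac{\psi}{\mathrm{lt}_s(\tilde G_i)}\tilde G_i$ with $\psi=\mathrm{lm}_{s-1}(\tilde F_j)$. If $\mathrm{lm}_{s-1}(\tilde F_j)\in R$ is divisible by no $\mathrm{lm}_s(\tilde G_i)$, let $\mathrm{spoly}(\tilde F_j)$ be the set of these elements for all $i$ and all lcms $\psi$ of $\mathrm{lm}_{s-1}(\tilde F_j)$ and $\mathrm{lm}_s(\tilde G_i)$. Then $B^{(s-1)}$ is the union of the set of all $\tilde G_i$ and of those $\tilde F_j$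 for which $\mathrm{lm}_{s-1}(\tilde F_j)\in R$ is divisible by no $\mathrm{lm}_s(\tilde G_i)$, and of the set $\bigcup_j\mathrm{spoly}(\tilde F_j)$, after each of these two sets has been reduced by removing elements whose leading monomial for $>_{s-1}$ is divisible by that of another remaining element, until there are no more such elements. *Output:* $(w^{(s)}\mid s\in S,\ s\le u)$. **Theorem.** For $s\in S$ let $\nu(s)=|\Delta(J)\cup\Delta(R\phi_s)|-s$, and let $d_u=\min_{s\in S,\,s\le u}\nu(s)$. If $d_u>2\,\mathrm{wt}(e)$, then the algorithm can be carried out (initial data exist, and no iteration gets stuck), and, whatever choices are made, it outputs $w^{(s)}=\omega_s$ for all $s\in S$, $s\le u$. Moreover, $d_u\ge n-u$ (without the condition on $e$). -/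

import Mathlib

open Polynomial

noncomputable section

/-- The data of a Miura–Kamiya curve
`y ^ a + ∑_{a i + b j < a b} c i j x ^ i y ^ j + d x ^ b = 0` over the field `F`. -/
structure MiuraKamiyaCurve (F : Type*) [Field F] where
  a : ℕ
  b : ℕ
  a_pos : 0 < a
  b_pos : 0 < b
  coprime : Nat.Coprime a b
  c : ℕ → ℕ → F
  d : F
  d_ne_zero : d ≠ 0

/-- Monomials of `R z ⊕ R`: `up t` is `φ_t z` and `down t` is `φ_t`, for a nongap `t`. -/
inductive Mono where
  | up (t : ℕ)
  | down (t : ℕ)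

namespace Mono

/-- The weighted degree of a monomial when `z` has weight `s`. -/
def weight (s : ℤ) : Mono → ℤ
  | up t => t + s
  | down t => t

def zdeg : Mono → ℕ
  | up _ => 1
  | down _ => 0

/-- The monomial order `≤_s`: compare weighted degrees, ties are broken by the `z`-degree. -/
def le (s : ℤ) (m m' : Mono) : Prop :=
  m.weight s < m'.weight s ∨ (m.weight s = m'.weight s ∧ m.zdeg ≤ m'.zdeg)

/-- The index of the monomial of `R` that occurs in the monomial. -/
def idx : Mono → ℕ
  | up t => t
  | down t => t

end Mono

namespace MiuraKamiyaCurve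

variable {F : Type*} [Field F] (X : MiuraKamiyaCurve F)

/-- The terms of the equation of the curve other than `y ^ a`, as a polynomial in `y` with
coefficients in `F[x]`. -/
def tail : F[X][X] :=
  (∑ j ∈ Finset.range X.a, ∑ i ∈ Finset.range X.b,
    if X.a * i + X.b * j < X.a * X.b then
      Polynomial.C (Polynomial.C (X.c i j) * Polynomial.X ^ i) * Polynomial.X ^ j else 0) +
    Polynomial.C (Polynomial.C X.d * Polynomial.X ^ X.b)

/-- The equation of the curve, as a polynomial in `y` with coefficients in `F[x]`. -/
def poly : F[X][X] := Polynomial.X ^ X.a + X.tail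

theorem tail_degree_lt : X.tail.degree < X.a := by
  have ha : (0 : WithBot ℕ) < X.a := by exact_mod_cast X.a_pos
  refine lt_of_le_of_lt (degree_add_le _ _) (max_lt ?_ (lt_of_le_of_lt degree_C_le ha))
  refine lt_of_le_of_lt (degree_sum_le _ _) ((Finset.sup_lt_iff (by simp)).2 ?_)
  intro j hj
  refine lt_of_le_of_lt (degree_sum_le _ _) ((Finset.sup_lt_iff (by simp)).2 ?_)
  intro i _
  split_ifs
  · refine lt_of_le_of_lt (degree_C_mul_X_pow_le _ _) ?_
    exact_mod_cast Finset.mem_range.1 hj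
  · simp

theorem monic_poly : X.poly.Monic := monic_X_pow_add X.tail_degree_lt

/-- The coordinate ring `R = F[x, y]` of the curve. -/
abbrev R : Type _ := AdjoinRoot X.poly

/-- The function `x` in `R`. -/
def x : X.R := AdjoinRoot.of X.poly Polynomial.X

/-- The function `y` in `R`. -/
def y : X.R := AdjoinRoot.root X.poly

/-- Constants in `R`. -/
def const (c : F) : X.R := AdjoinRoot.of X.poly (Polynomial.C c)

/-- The semigroup `S = ⟨a, b⟩` of nongaps. -/
def S : Set ℕ := {t | ∃ i j : ℕ, t = X.a * i + X.b * j}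

/-- The exponent `j` of `y` in `φ_s = x ^ i y ^ j`, namely `b' s mod a` with `b' b ≡ 1 mod a`. -/
def expY (s : ℕ) : ℕ := (((X.b : ZMod X.a)⁻¹ * (s : ZMod X.a) : ZMod X.a)).val

/-- The exponent `i` of `x` in `φ_s = x ^ i y ^ j`, namely `(s - b j) / a`. -/
def expX (s : ℕ) : ℕ := (s - X.b * X.expY s) / X.a

/-- For a nongap `s`, the unique monomial `x ^ i y ^ j`, `j < a`, with `a i + b j = s`. -/
def phi (s : ℕ) : X.R := X.x ^ X.expX s * X.y ^ X.expY s

/-- The normal form of an element of `R`: the representative of degree `< a` in `y`. -/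
def normalForm (f : X.R) : F[X][X] := AdjoinRoot.modByMonicHom X.monic_poly f

/-- For a nongap `s`, the coefficient of the monomial `φ_s` in `f`. -/
def coeff (f : X.R) (s : ℕ) : F := ((X.normalForm f).coeff (X.expY s)).coeff (X.expX s)

/-- The pole order `δ(f)` at infinity of `f ≠ 0`: the largest `a i + b j` such that
`x ^ i y ^ j`, `j < a`, occurs in `f`. The value at `f = 0` is `0` and is not used. -/
def delta (f : X.R) : ℕ :=
  (X.normalForm f).support.sup fun j =>
    ((X.normalForm f).coeff j).support.sup fun i => X.a * i + X.b * j

/-- The leading coefficient of an element of `R`. -/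
def lc (f : X.R) : F := X.coeff f (X.delta f)

/-- `s` divides `t`, for nongaps: `t - s` is a nongap. -/
def Dvd (s t : ℕ) : Prop := ∃ r ∈ X.S, t = s + r

/-- `l` is a common multiple of the nongaps `s` and `t`. -/
def IsCommonMultiple (s t l : ℕ) : Prop := X.Dvd s l ∧ X.Dvd t l

/-- `l` is an lcm of the nongaps `s` and `t`: a common multiple that is minimal for
divisibility. -/
def IsLcm (s t l : ℕ) : Prop :=
  X.IsCommonMultiple s t l ∧ ∀ l', X.IsCommonMultiple s t l' → X.Dvd l' l → l' = l

/-- The leading monomials of the nonzero elements of an ideal (`φ_t` is represented by `t`). -/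
def sigma (I : Ideal X.R) : Set ℕ := {t | ∃ f ∈ I, f ≠ 0 ∧ X.delta f = t}

/-- The monomials of `R` that are not in `sigma I`. -/
def Delta (I : Ideal X.R) : Set ℕ := X.S \ X.sigma I

/-- The monomials of `R` divisible by the leading monomial of some nonzero element of `T`. -/
def sigmaGen (T : Set X.R) : Set ℕ := {t | ∃ f ∈ T, f ≠ 0 ∧ X.Dvd (X.delta f) t}

/-- The monomials of `R` that are not in `sigmaGen T`. -/
def DeltaGen (T : Set X.R) : Set ℕ := X.S \ X.sigmaGen T

/-- A Gröbner basis of an ideal of `R`. -/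
def IsGroebnerBasis (I : Ideal X.R) (η : Set X.R) : Prop :=
  (∀ g ∈ η, g ∈ I ∧ g ≠ 0) ∧ ∀ f ∈ I, f ≠ 0 → ∃ g ∈ η, X.Dvd (X.delta g) (X.delta f)

/-! ### Points and codes -/

/-- The (affine) rational points of the curve. -/
def Point : Type _ := {p : F × F // X.poly.evalEval p.1 p.2 = 0}

/-- The value of a function at a rational point. -/
def evalAt (p : X.Point) (f : X.R) : F := AdjoinRoot.evalEval p.2 f

/-- The maximal ideal `⟨x - α, y - β⟩` of the point `(α, β)`. -/
def maxIdeal (p : X.Point) : Ideal X.R :=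
  Ideal.span {X.x - X.const p.1.1, X.y - X.const p.1.2}

variable {n : ℕ}

def ev (P : Fin n ↪ X.Point) (f : X.R) : Fin n → F := fun i => X.evalAt (P i) f

/-- The ideal `J` of the set of points. -/
def J (P : Fin n ↪ X.Point) : Ideal X.R := ⨅ i, X.maxIdeal (P i)

open Classical in
/-- The nongaps `≤ u`. -/
def nongapsLE (u : ℕ) : Finset ℕ := (Finset.range (u + 1)).filter (· ∈ X.S)

theorem nongapsLE_nonempty (u : ℕ) : (X.nongapsLE u).Nonempty :=
  ⟨0, by simp only [nongapsLE, Finset.mem_filter]; exact ⟨by simp, 0, 0, by simp⟩⟩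

/-- The function `μ = ∑ ω_s φ_s` over the nongaps `s ≤ u`. -/
def message (u : ℕ) (ω : ℕ → F) : X.R := ∑ s ∈ X.nongapsLE u, X.const (ω s) * X.phi s

/-- `ν(s) = |Δ(J) ∪ Δ(R φ_s)| - s`. -/
def nu (P : Fin n ↪ X.Point) (s : ℕ) : ℤ :=
  ((X.Delta (X.J P) ∪ X.Delta (Ideal.span {X.phi s})).ncard : ℤ) - s

/-- `d_u`, the minimum of `ν(s)` over the nongaps `s ≤ u`. -/
def du (P : Fin n ↪ X.Point) (u : ℕ) : ℤ :=
  (X.nongapsLE u).inf' (X.nongapsLE_nonempty u) (X.nu P)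

/-! ### Leading monomials in `R z ⊕ R`

An element `f = f^U z + f^D` is the pair `(f^U, f^D)`. -/

/-- The coefficient of a monomial in an element of `R z ⊕ R`. -/
def coeff₂ (f : X.R × X.R) : Mono → F
  | .up t => X.coeff f.1 t
  | .down t => X.coeff f.2 t

/-- The monomials that occur in an element of `R z ⊕ R`. -/
def supp (f : X.R × X.R) : Set Mono := {m | m.idx ∈ X.S ∧ X.coeff₂ f m ≠ 0}

/-- `m` is the leading monomial `lm_s(f)` of `f` with respect to `>_s`. -/
def IsLM (s : ℤ) (f : X.R × X.R) (m : Mono) : Prop :=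
  m ∈ X.supp f ∧ ∀ m' ∈ X.supp f, Mono.le s m' m

/-- Divisibility of monomials of `R z ⊕ R`. -/
def MonoDvd : Mono → Mono → Prop
  | .up t, .up t' => X.Dvd t t'
  | .down t, .down t' => X.Dvd t t'
  | _, _ => False

/-- The elements `F_j` of `B`: those with `lm_s` in `R z`. -/
def upPart (s : ℤ) (B : Set (X.R × X.R)) : Set (X.R × X.R) :=
  {f | f ∈ B ∧ ∃ t, X.IsLM s f (.up t)}

/-- The elements `G_i` of `B`: those with `lm_s` in `R`. -/
def downPart (s : ℤ) (B : Set (X.R × X.R)) : Set (X.R × X.R) :=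
  {f | f ∈ B ∧ ∃ t, X.IsLM s f (.down t)}

/-- The monomials of `R z ⊕ R` that are divisible by no leading monomial `lm_s(g)`, `g ∈ T`. -/
def DeltaGen₂ (s : ℤ) (T : Set (X.R × X.R)) : Set Mono :=
  {m | m.idx ∈ X.S ∧ ∀ g ∈ T, ∀ p, X.IsLM s g p → ¬ X.MonoDvd p m}

/-! ### Step M1: message guessing -/

/-- The substitution `f ↦ f(z + w φ_s)`. -/
def shift (s : ℕ) (w : F) (f : X.R × X.R) : X.R × X.R :=
  (f.1, f.2 + X.const w * X.phi s * f.1)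

/-- The value `w_j` of `F_j = f`: minus the coefficient in `f^D` of the monomial
`lm(f^U φ_s)`, divided by the leading coefficient of `f^U φ_s`. -/
def vote (s : ℕ) (f : X.R × X.R) : F :=
  -(X.coeff f.2 (X.delta (f.1 * X.phi s)) / X.lc (f.1 * X.phi s))

/-- The set `W` of all `w_j`. -/
def W (s : ℕ) (B : Set (X.R × X.R)) : Set F := X.vote s '' X.upPart s B

/-- The number `d_c = |⋃_{w_j = c} Σ(F_j^U φ_s) ∩ Δ({G_i^D})|`. -/
def dc (s : ℕ) (B : Set (X.R × X.R)) (c : F) : ℕ :=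
  (⋃ f ∈ {f | f ∈ X.upPart s B ∧ X.vote s f = c},
    X.sigmaGen {f.1 * X.phi s} ∩ X.DeltaGen (Prod.snd '' X.downPart s B)).ncard

/-- `c` is an admissible guess: an element of `W` with largest `d_c`. -/
def IsGuess (s : ℕ) (B : Set (X.R × X.R)) (c : F) : Prop :=
  c ∈ X.W s B ∧ ∀ c' ∈ X.W s B, X.dc s B c' ≤ X.dc s B c

/-! ### Step M2: Gröbner basis update -/

/-- The quotient `φ_l / lt(g)`: the scalar multiple `λ` of `φ_{l - δ(g)}` for which
`λ g` has leading term `φ_l`. -/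
def quotTerm (l : ℕ) (g : X.R) : X.R :=
  X.const (X.lc (X.phi (l - X.delta g) * g))⁻¹ * X.phi (l - X.delta g)

/-- The combination `(φ_l / lt(f)) f - (φ_l / lt(g)) g` for `f`, `g` whose leading terms are
those of `f^D`, `g^D`. -/
def scomb (l : ℕ) (f g : X.R × X.R) : X.R × X.R :=
  X.quotTerm l f.2 • f - X.quotTerm l g.2 • g

/-- `A` is an admissible value of `spoly(f)`, for the passage from `>_s` to `>_{s-1}`, where
`G` is the set of the `G_i`. If `lm_{s-1}(f)` is a multiple of some `lm_s(G_i)`, then one such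
`i` is chosen. -/
def IsSpoly (s : ℤ) (G : Set (X.R × X.R)) (f : X.R × X.R) (A : Set (X.R × X.R)) : Prop :=
  (∃ t, X.IsLM (s - 1) f (.up t) ∧ A = {f}) ∨
  (∃ t, X.IsLM (s - 1) f (.down t) ∧
    ∃ g ∈ G, ∃ p, X.IsLM s g (.down p) ∧ X.Dvd p t ∧ A = {X.scomb t f g}) ∨
  (∃ t, X.IsLM (s - 1) f (.down t) ∧ Mono.down t ∈ X.DeltaGen₂ s G ∧
    A = {h | ∃ g ∈ G, ∃ p l, X.IsLM s g (.down p) ∧ X.IsLcm t p l ∧ h = X.scomb l f g})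

/-- `A'` arises from `A` by removing elements whose leading term (for `>_s`) is divisible by
that of another element, until none is left. -/
def IsReduction (s : ℤ) (A A' : Set (X.R × X.R)) : Prop :=
  A' ⊆ A ∧
  (∀ f ∈ A, ∃ g ∈ A', ∃ m p, X.IsLM s f m ∧ X.IsLM s g p ∧ X.MonoDvd p m) ∧
  (∀ f ∈ A', ∀ g ∈ A', ∀ m p, X.IsLM s f m → X.IsLM s g p → X.MonoDvd p m → g = f)

/-- `B'` is an admissible result of step M2 applied to `B`. -/
def IsUpdate (s : ℤ) (B B' : Set (X.R × X.R)) : Prop :=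
  ∃ (A : X.R × X.R → Set (X.R × X.R)) (B₁ B₂ : Set (X.R × X.R)),
    (∀ f ∈ X.upPart s B, X.IsSpoly s (X.downPart s B) f (A f)) ∧
    X.IsReduction (s - 1)
      (X.downPart s B ∪ {f | f ∈ X.upPart s B ∧
        ∃ t, X.IsLM (s - 1) f (.down t) ∧ Mono.down t ∈ X.DeltaGen₂ s (X.downPart s B)}) B₁ ∧
    X.IsReduction (s - 1) (⋃ f ∈ X.upPart s B, A f) B₂ ∧
    B' = B₁ ∪ B₂

/-! ### The algorithm -/

/-- A state of the algorithm: the index `s` of the iteration to be carried out next, the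
current basis `B^{(s)}`, and the coefficients `w^{(t)}` guessed so far (`0` where no guess has
been made). The algorithm stops when `s < 0`. -/
structure State where
  s : ℤ
  B : Set (X.R × X.R)
  w : ℕ → F

/-- The initial states for the received vector `v`: the basis is `{η_i} ∪ {z - h}` with
`ev h = v`, where `{η_i}` is a finite Gröbner basis of `J`, and `s = δ(h)`; there is no iteration
if `h = 0`. -/
def IsInit (P : Fin n ↪ X.Point) (v : Fin n → F) (σ : X.State) : Prop :=
  ∃ (h : X.R) (η : Set X.R), X.ev P h = v ∧ η.Finite ∧ X.IsGroebnerBasis (X.J P) η ∧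
    σ.B = (fun g => ((0 : X.R), g)) '' η ∪ {((1 : X.R), -h)} ∧
    ((h = 0 ∧ σ.s = -1) ∨ (h ≠ 0 ∧ σ.s = X.delta h)) ∧
    σ.w = 0

/-- One iteration, consisting of M1 and M2. -/
def Step (u : ℕ) (σ σ' : X.State) : Prop :=
  ∃ (k : ℕ) (B : Set (X.R × X.R)), σ.s = k ∧ σ'.s = k - 1 ∧
    ((k ∈ X.S ∧ k ≤ u ∧ ∃ c, X.IsGuess k σ.B c ∧ B = X.shift k c '' σ.B ∧
        σ'.w = Function.update σ.w k c) ∨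
      (¬ (k ∈ X.S ∧ k ≤ u) ∧ B = σ.B ∧ σ'.w = σ.w)) ∧
    X.IsUpdate k B σ'.B

end MiuraKamiyaCurve

end

/-!
Before iteration `k` the received word behaves like `e + ev(μ_k)`, where `μ_k` is the part of the
message in the `φ_t` with `t ≤ k`, and the basis `B` lies in the module of all `f ∈ R z ⊕ R` that
vanish at the points for `z = e + ev(μ_k)`. Linear algebra shows that the footprint of this module
has exactly `n` elements. Neither the substitution in M1 nor the S-polynomials in M2 enlarge the
footprint of `B`, which has at most `n` elements at the start; hence `B` remains a Gröbner basis.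

The substitution `z = μ_k` takes `f ∈ B` to a function that vanishes at all error-free points. The
leading monomials of the `F_j` with a wrong vote therefore lie outside the footprint, of size
`n - wt(e)`, of the ideal of these points, which bounds all wrong `d_c`; the remaining monomials
vote for `ω_k`. A count of footprints with `ν(k) > 2 wt(e)` gives the right candidate the majority.
-/

noncomputable section

/-! ### Finite sets -/

theorem mapsTo_and_injOn_mod {T : Set ℕ} {m : ℕ} (hT : ∀ t ∈ T, ∀ k, t + m * (k + 1) ∉ T) :
    Set.MapsTo (· % m) T (Set.Iio m) ∧ Set.InjOn (· % m) T := by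
  refine ⟨fun t ht => Nat.mod_lt t (Nat.pos_of_ne_zero ?_), ?_⟩
  · rintro rfl
    exact hT t ht 0 (by simpa using ht)
  have hnotlt : ∀ t ∈ T, ∀ t' ∈ T, t % m = t' % m → ¬ t < t' := by
    intro t ht t' ht' hmod hlt
    obtain ⟨k, hk⟩ := (Nat.modEq_iff_dvd' hlt.le).1 hmod
    obtain _ | k := k
    · omega
    · exact hT t ht k (by rwa [← hk, Nat.add_sub_cancel' hlt.le])
  intro t ht t' ht' hmod
  exact le_antisymm (not_lt.1 (hnotlt t' ht' t ht hmod.symm)) (not_lt.1 (hnotlt t ht t' ht' hmod))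

theorem finite_of_forall_add_mul_notMem {T : Set ℕ} {m : ℕ}
    (hT : ∀ t ∈ T, ∀ k, t + m * (k + 1) ∉ T) : T.Finite :=
  Set.Finite.of_injOn (mapsTo_and_injOn_mod hT).1 (mapsTo_and_injOn_mod hT).2 (Set.finite_Iio m)

theorem ncard_le_of_forall_add_mul_notMem {T : Set ℕ} {m : ℕ}
    (hT : ∀ t ∈ T, ∀ k, t + m * (k + 1) ∉ T) : T.ncard ≤ m := by
  simpa using Set.ncard_le_ncard_of_injOn _ (mapsTo_and_injOn_mod hT).1
    (mapsTo_and_injOn_mod hT).2 (Set.finite_Iio m)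

theorem finite_and_ncard_le_of_injOn_sdiff {α : Type*} {T U : Set α} (hU : U.Finite) (f : α → α)
    (hf : Set.MapsTo f (T \ U) (U \ T)) (hinj : Set.InjOn f (T \ U)) :
    T.Finite ∧ T.ncard ≤ U.ncard := by
  have hT : T.Finite := by
    have hsdiff := Set.Finite.of_injOn hf hinj hU.sdiff
    exact (hsdiff.union hU).subset (by rw [Set.sdiff_union_self]; exact Set.subset_union_left)
  exact ⟨hT, (Set.ncard_le_ncard_iff_ncard_sdiff_le_ncard_sdiff hT hU).2
    (Set.ncard_le_ncard_of_injOn f hf hinj hU.sdiff)⟩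

/-! ### Leading indices with respect to a ranked basis -/

section LeadIndex

variable {K V W ι α : Type*} [Field K] [AddCommGroup V] [Module K V] [AddCommGroup W] [Module K W]
  [LinearOrder α]

/-- `i` is the index of the leading term of `v` in the basis `b`, when the basis vectors are
ordered by `rk`. -/
def IsLeadIndex (b : Module.Basis ι K V) (rk : ι → α) (v : V) (i : ι) : Prop :=
  b.repr v i ≠ 0 ∧ ∀ j, b.repr v j ≠ 0 → rk j ≤ rk i

/-- The indices that are not the leading index of an element of the subspace `N`; this is the
linear-algebra form of the footprint `Δ(I)` of an ideal. -/
def standardIndices (b : Module.Basis ι K V) (rk : ι → α) (N : Submodule K V) : Set ι :=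
  {i | ∀ v ∈ N, ¬ IsLeadIndex b rk v i}

variable (b : Module.Basis ι K V) (rk : ι → α)

theorem exists_isLeadIndex {v : V} (hv : v ≠ 0) : ∃ i, IsLeadIndex b rk v i := by
  have hsupp : (b.repr v).support.Nonempty := by simpa using hv
  obtain ⟨i, hi, hmax⟩ := Finset.exists_max_image _ rk hsupp
  exact ⟨i, by simpa using hi, fun j hj => hmax j (by simpa using hj)⟩

variable {rk} in
theorem IsLeadIndex.sub_mem_span (hrk : rk.Injective) {v : V} {i : ι}
    (hv : IsLeadIndex b rk v i) :
    v - b.repr v i • b i ∈ Submodule.span K (b '' {j | rk j < rk i}) := by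
  rw [b.mem_span_image]
  intro j hj
  have hj : b.repr v j - Finsupp.single i (b.repr v i) j ≠ 0 := by simpa using hj
  have hji : j ≠ i := by
    rintro rfl
    simp at hj
  rw [Finsupp.single_eq_of_ne hji, sub_zero] at hj
  exact (hv.2 j hj).lt_of_ne (hrk.ne hji)

theorem linearIndependent_mkQ_standardIndices (N : Submodule K V) :
    LinearIndependent K fun i : standardIndices b rk N => N.mkQ (b i) := by
  refine (b.linearIndependent.comp _ Subtype.val_injective).map ?_
  rw [N.ker_mkQ, Submodule.disjoint_def]
  intro v hv hvN
  rw [Set.range_comp, Subtype.range_coe, b.mem_span_image] at hv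
  by_contra hv0
  obtain ⟨i, hi⟩ := exists_isLeadIndex b rk hv0
  exact hv (by simpa using hi.1) v hvN hi

variable [WellFoundedLT α]

variable {rk} in
theorem basis_mem_sup_span_standardIndices (hrk : rk.Injective) (N : Submodule K V) (i : ι) :
    b i ∈ N ⊔ Submodule.span K (b '' standardIndices b rk N) := by
  induction h : rk i using WellFoundedLT.induction generalizing i with
  | ind r ih =>
  subst h
  by_cases hi : i ∈ standardIndices b rk N
  · exact Submodule.mem_sup_right (Submodule.subset_span ⟨i, hi, rfl⟩)
  obtain ⟨v, hvN, hv⟩ : ∃ v ∈ N, IsLeadIndex b rk v i := by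
    simpa [standardIndices] using hi
  have hlower : v - b.repr v i • b i ∈ N ⊔ Submodule.span K (b '' standardIndices b rk N) := by
    refine Submodule.span_le.2 ?_ (hv.sub_mem_span b hrk)
    rintro _ ⟨j, hj, rfl⟩
    exact ih _ hj j rfl
  have hscaled := Submodule.sub_mem _ (Submodule.mem_sup_left hvN) hlower
  rw [sub_sub_cancel] at hscaled
  exact (Submodule.smul_mem_iff _ hv.1).1 hscaled

variable {rk} in
theorem span_mkQ_standardIndices (hrk : rk.Injective) (N : Submodule K V) :
    ⊤ ≤ Submodule.span K (Set.range fun i : standardIndices b rk N => N.mkQ (b i)) := by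
  have hsup : N ⊔ Submodule.span K (b '' standardIndices b rk N) = ⊤ := by
    rw [eq_top_iff, ← b.span_eq, Submodule.span_le, Set.range_subset_iff]
    exact basis_mem_sup_span_standardIndices b hrk N
  have hrange : (Set.range fun i : standardIndices b rk N => N.mkQ (b i)) =
      N.mkQ '' (b '' standardIndices b rk N) := by
    rw [Set.image_image, Set.image_eq_range]
  rw [hrange, Submodule.span_image, (N.map_mkQ_eq_top _).2 hsup]

variable {rk} {b}

theorem finite_standardIndices_ker [Module.Finite K W] (hrk : rk.Injective) {L : V →ₗ[K] W}
    (hL : Function.Surjective L) : (standardIndices b rk (LinearMap.ker L)).Finite :=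
  have := Module.Finite.equiv (L.quotKerEquivOfSurjective hL).symm
  Module.Finite.finite_basis (.mk (linearIndependent_mkQ_standardIndices b rk (LinearMap.ker L))
    (span_mkQ_standardIndices b hrk _))

theorem ncard_standardIndices_ker (hrk : rk.Injective) {L : V →ₗ[K] W}
    (hL : Function.Surjective L) :
    (standardIndices b rk (LinearMap.ker L)).ncard = Module.finrank K W := by
  rw [← (L.quotKerEquivOfSurjective hL).finrank_eq, Module.finrank_eq_nat_card_basis
    (.mk (linearIndependent_mkQ_standardIndices b rk (LinearMap.ker L))
      (span_mkQ_standardIndices b hrk _))]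
  rfl

end LeadIndex

/-! ### Monomials of `R z ⊕ R` -/

namespace Mono

/-- The rank of a monomial for the order `>_k`: twice the weight, plus the `z`-degree. -/
def rank (k : ℕ) : Mono → ℕ
  | up t => 2 * (t + k) + 1
  | down t => 2 * t

theorem rank_injective (k : ℕ) : (rank k).Injective := by
  rintro (t | t) (t' | t') h <;> simp only [rank] at h
  · exact congrArg up (by omega)
  · omega
  · omega
  · exact congrArg down (by omega)

theorem le_iff_rank_le {k : ℕ} {m m' : Mono} : le k m m' ↔ m.rank k ≤ m'.rank k := by
  rcases m with t | t <;> rcases m' with t' | t' <;> simp only [le, weight, zdeg, rank] <;> omega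

theorem le_antisymm {s : ℤ} {m m' : Mono} (h : le s m m') (h' : le s m' m) : m = m' := by
  rcases m with t | t <;> rcases m' with t' | t' <;> simp only [le, weight, zdeg] at h h' <;>
    simp <;> omega

theorem ncard_eq_ncard_preimage_up_add {T : Set Mono} (hT : T.Finite) :
    T.ncard = (up ⁻¹' T).ncard + (down ⁻¹' T).ncard := by
  have hup : up.Injective := fun _ _ => up.inj
  have hdown : down.Injective := fun _ _ => down.inj
  have hunion : T = up '' (up ⁻¹' T) ∪ down '' (down ⁻¹' T) := by
    ext (t | t) <;> simp
  have hdisj : Disjoint (up '' (up ⁻¹' T)) (down '' (down ⁻¹' T)) := by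
    rw [Set.disjoint_left]
    rintro _ ⟨t, -, rfl⟩ ⟨t', -, h⟩
    cases h
  conv_lhs => rw [hunion]
  rw [Set.ncard_union_eq hdisj ((hT.preimage hup.injOn).image _)
    ((hT.preimage hdown.injOn).image _), Set.ncard_image_of_injective _ hup,
    Set.ncard_image_of_injective _ hdown]

end Mono

namespace MiuraKamiyaCurve

variable {F : Type*} [Field F] {X : MiuraKamiyaCurve F}

/-! ### Nongaps -/

theorem zero_mem_S : 0 ∈ X.S := ⟨0, 0, by simp⟩

theorem add_mem_S {s t : ℕ} (hs : s ∈ X.S) (ht : t ∈ X.S) : s + t ∈ X.S := by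
  obtain ⟨i, j, rfl⟩ := hs
  obtain ⟨k, l, rfl⟩ := ht
  exact ⟨i + k, j + l, by ring⟩

theorem mul_mem_S {s : ℕ} (hs : s ∈ X.S) (k : ℕ) : s * k ∈ X.S := by
  obtain ⟨i, j, rfl⟩ := hs
  exact ⟨i * k, j * k, by ring⟩

theorem a_mem_S : X.a ∈ X.S := ⟨1, 0, by simp⟩

theorem Dvd.refl (s : ℕ) : X.Dvd s s := ⟨0, zero_mem_S, rfl⟩

theorem Dvd.trans {s t r : ℕ} (hst : X.Dvd s t) (htr : X.Dvd t r) : X.Dvd s r := by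
  obtain ⟨p, hp, rfl⟩ := hst
  obtain ⟨q, hq, rfl⟩ := htr
  exact ⟨p + q, add_mem_S hp hq, by ring⟩

theorem Dvd.mem_S {s t : ℕ} (h : X.Dvd s t) (hs : s ∈ X.S) : t ∈ X.S := by
  obtain ⟨r, hr, rfl⟩ := h
  exact add_mem_S hs hr

theorem Dvd.le {s t : ℕ} (h : X.Dvd s t) : s ≤ t := by
  obtain ⟨r, -, rfl⟩ := h
  exact Nat.le_add_right s r

theorem Dvd.add_right {s t : ℕ} (h : X.Dvd s t) (k : ℕ) : X.Dvd (s + k) (t + k) := by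
  obtain ⟨r, hr, rfl⟩ := h
  exact ⟨r, hr, by ring⟩

theorem expY_lt (s : ℕ) : X.expY s < X.a :=
  have : NeZero X.a := ⟨X.a_pos.ne'⟩
  ZMod.val_lt _

theorem expY_eq (i : ℕ) {j : ℕ} (hj : j < X.a) : X.expY (X.a * i + X.b * j) = j := by
  have hinv : (X.b : ZMod X.a)⁻¹ * X.b = 1 := by
    rw [mul_comm, ZMod.coe_mul_inv_eq_one _ X.coprime.symm]
  rw [expY, Nat.cast_add, Nat.cast_mul, Nat.cast_mul, ZMod.natCast_self, zero_mul, zero_add,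
    ← mul_assoc, hinv, one_mul, ZMod.val_natCast, Nat.mod_eq_of_lt hj]

theorem expX_eq (i : ℕ) {j : ℕ} (hj : j < X.a) : X.expX (X.a * i + X.b * j) = i := by
  rw [expX, expY_eq i hj, Nat.add_sub_cancel, Nat.mul_div_cancel_left _ X.a_pos]

theorem exists_eq_of_mem_S {s : ℕ} (hs : s ∈ X.S) : ∃ i, ∃ j < X.a, s = X.a * i + X.b * j := by
  obtain ⟨i, j, rfl⟩ := hs
  refine ⟨i + X.b * (j / X.a), j % X.a, Nat.mod_lt _ X.a_pos, ?_⟩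
  conv_lhs => rw [← Nat.div_add_mod j X.a]
  ring

theorem exp_spec {s : ℕ} (hs : s ∈ X.S) : X.a * X.expX s + X.b * X.expY s = s := by
  obtain ⟨i, j, hj, rfl⟩ := exists_eq_of_mem_S hs
  rw [expX_eq i hj, expY_eq i hj]

/-! ### The monomial basis and its filtration -/

theorem natDegree_poly : X.poly.natDegree = X.a := by
  rw [poly, natDegree_add_eq_left_of_degree_lt, natDegree_X_pow]
  rw [degree_X_pow]
  exact X.tail_degree_lt

theorem dim_powerBasis : (AdjoinRoot.powerBasis' X.monic_poly).dim = X.a := by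
  rw [AdjoinRoot.powerBasis'_dim, natDegree_poly]

variable (X) in
/-- A nongap `s` corresponds to the exponents `(i, j)`, `j < a`, of `φ_s = x ^ i y ^ j`. -/
def expEquiv : ℕ × Fin (AdjoinRoot.powerBasis' X.monic_poly).dim ≃ X.S where
  toFun ij := ⟨X.a * ij.1 + X.b * ij.2, ij.1, ij.2, rfl⟩
  invFun s := (X.expX s, ⟨X.expY s, (expY_lt _).trans_eq dim_powerBasis.symm⟩)
  left_inv ij := by
    have hj : (ij.2 : ℕ) < X.a := ij.2.2.trans_eq dim_powerBasis
    simp [expX_eq _ hj, expY_eq _ hj]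
  right_inv s := Subtype.ext (exp_spec s.2)

variable (X) in
/-- The `F`-basis of `R` formed by the monomials `φ_s`, indexed by the nongaps `s`. -/
def phiBasis : Module.Basis X.S F X.R :=
  ((basisMonomials F).smulTower (AdjoinRoot.powerBasis' X.monic_poly).basis).reindex X.expEquiv

@[simp] theorem phiBasis_apply (s : X.S) : X.phiBasis s = X.phi s := by
  rw [phiBasis, Module.Basis.reindex_apply, Module.Basis.smulTower_apply, PowerBasis.basis_eq_pow,
    AdjoinRoot.powerBasis'_gen, coe_basisMonomials, Algebra.smul_def]
  beta_reduce
  rw [monomial_one_right_eq_X_pow, map_pow]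
  rfl

@[simp] theorem phiBasis_repr (f : X.R) (s : X.S) : X.phiBasis.repr f s = X.coeff f s := by
  rw [phiBasis, Module.Basis.repr_reindex_apply, Module.Basis.smulTower_repr]
  rfl

theorem const_mul (c : F) (f : X.R) : X.const c * f = c • f := by
  rw [Algebra.smul_def]
  rfl

variable (X) in
/-- The coefficient of `φ_s`, as a linear form on `R`. -/
def coeffHom (s : ℕ) : X.R →ₗ[F] F :=
  lcoeff F (X.expX s) ∘ₗ
    (lcoeff F[X] (X.expY s) ∘ₗ AdjoinRoot.modByMonicHom X.monic_poly).restrictScalars F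

theorem coeff_add (f g : X.R) (s : ℕ) : X.coeff (f + g) s = X.coeff f s + X.coeff g s :=
  map_add (X.coeffHom s) f g

theorem coeff_sub (f g : X.R) (s : ℕ) : X.coeff (f - g) s = X.coeff f s - X.coeff g s :=
  map_sub (X.coeffHom s) f g

theorem coeff_smul (c : F) (f : X.R) (s : ℕ) : X.coeff (c • f) s = c * X.coeff f s :=
  map_smul (X.coeffHom s) c f

theorem coeff_sum {ι : Type*} (A : Finset ι) (f : ι → X.R) (s : ℕ) :
    X.coeff (∑ i ∈ A, f i) s = ∑ i ∈ A, X.coeff (f i) s :=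
  map_sum (X.coeffHom s) f A

theorem coeff_zero (s : ℕ) : X.coeff 0 s = 0 := map_zero (X.coeffHom s)

theorem ext_coeff {f g : X.R} (h : ∀ s ∈ X.S, X.coeff f s = X.coeff g s) : f = g :=
  X.phiBasis.ext_elem fun s => by simpa using h s s.2

theorem coeff_phi {s t : ℕ} (hs : s ∈ X.S) (ht : t ∈ X.S) :
    X.coeff (X.phi s) t = if s = t then 1 else 0 := by
  have h := phiBasis_repr (X.phiBasis ⟨s, hs⟩) ⟨t, ht⟩
  rw [Module.Basis.repr_self, Finsupp.single_apply, phiBasis_apply] at h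
  simpa using h.symm

variable (X) in
/-- The functions of pole order at most `N`; the bound is an integer so that it can be shifted by
the weight of `z`. -/
def deltaLE (N : ℤ) : Submodule F X.R :=
  Submodule.span F (X.phiBasis '' {t | ((t : ℕ) : ℤ) ≤ N})

theorem mem_deltaLE {N : ℤ} {f : X.R} :
    f ∈ X.deltaLE N ↔ ∀ t ∈ X.S, X.coeff f t ≠ 0 → (t : ℤ) ≤ N := by
  rw [deltaLE, Module.Basis.mem_span_image]
  simp [Set.subset_def]

theorem deltaLE_mono {N M : ℤ} (h : N ≤ M) : X.deltaLE N ≤ X.deltaLE M :=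
  Submodule.span_mono (Set.image_mono fun _ ht => le_trans ht h)

theorem coeff_eq_zero_of_mem_deltaLE {N : ℤ} {f : X.R} (hf : f ∈ X.deltaLE N) {t : ℕ}
    (ht : t ∈ X.S) (h : N < t) : X.coeff f t = 0 := by
  by_contra hne
  exact h.not_ge (mem_deltaLE.1 hf t ht hne)

theorem mem_deltaLE_sub_one {N : ℤ} {f : X.R} (hf : f ∈ X.deltaLE N)
    (h : ∀ t ∈ X.S, (t : ℤ) = N → X.coeff f t = 0) : f ∈ X.deltaLE (N - 1) := by
  refine mem_deltaLE.2 fun t ht hne => ?_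
  have hle := mem_deltaLE.1 hf t ht hne
  have hne' : (t : ℤ) ≠ N := fun h' => hne (h t ht h')
  omega

variable (X) in
/-- `φ_t` is the leading monomial of `f`. -/
def HasLead (f : X.R) (t : ℕ) : Prop := t ∈ X.S ∧ X.coeff f t ≠ 0 ∧ f ∈ X.deltaLE t

theorem hasLead_phi {s : ℕ} (hs : s ∈ X.S) : X.HasLead (X.phi s) s :=
  ⟨hs, by simp [coeff_phi hs hs],
    Submodule.subset_span ⟨⟨s, hs⟩, le_refl (s : ℤ), phiBasis_apply _⟩⟩

namespace HasLead

variable {f g : X.R} {s t : ℕ}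

theorem mem_S (h : X.HasLead f t) : t ∈ X.S := h.1

theorem coeff_ne_zero (h : X.HasLead f t) : X.coeff f t ≠ 0 := h.2.1

theorem mem_deltaLE (h : X.HasLead f t) : f ∈ X.deltaLE t := h.2.2

theorem ne_zero (h : X.HasLead f t) : f ≠ 0 := by
  rintro rfl
  exact h.coeff_ne_zero (coeff_zero t)

theorem unique (hs : X.HasLead f s) (ht : X.HasLead f t) : s = t :=
  le_antisymm
    (by exact_mod_cast MiuraKamiyaCurve.mem_deltaLE.1 ht.mem_deltaLE s hs.mem_S hs.coeff_ne_zero)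
    (by exact_mod_cast MiuraKamiyaCurve.mem_deltaLE.1 hs.mem_deltaLE t ht.mem_S ht.coeff_ne_zero)

theorem smul (h : X.HasLead f t) {c : F} (hc : c ≠ 0) : X.HasLead (c • f) t :=
  ⟨h.mem_S, by simpa [coeff_smul] using ⟨hc, h.coeff_ne_zero⟩,
    Submodule.smul_mem _ _ h.mem_deltaLE⟩

theorem add (h : X.HasLead f t) (hg : g ∈ X.deltaLE (t - 1)) : X.HasLead (f + g) t := by
  refine ⟨h.mem_S, ?_, add_mem h.mem_deltaLE (deltaLE_mono (by omega) hg)⟩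
  rw [coeff_add, coeff_eq_zero_of_mem_deltaLE hg h.mem_S (by omega), add_zero]
  exact h.coeff_ne_zero

theorem sub (h : X.HasLead f t) (hg : g ∈ X.deltaLE (t - 1)) : X.HasLead (f - g) t :=
  sub_eq_add_neg f g ▸ h.add (neg_mem hg)

theorem sub_mem_deltaLE (h : X.HasLead f t) :
    f - X.coeff f t • X.phi t ∈ X.deltaLE (t - 1) := by
  refine mem_deltaLE_sub_one
    (sub_mem h.mem_deltaLE (Submodule.smul_mem _ _ (hasLead_phi h.mem_S).mem_deltaLE)) ?_
  intro r hr hrt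
  obtain rfl : r = t := by exact_mod_cast hrt
  rw [coeff_sub, coeff_smul, coeff_phi hr hr, if_pos rfl, mul_one, sub_self]

end HasLead

/-! ### Leading monomials of products -/

theorem x_pow_mul_y_pow (i j : ℕ) :
    X.x ^ i * X.y ^ j = AdjoinRoot.mk X.poly (C (Polynomial.X ^ i) * Polynomial.X ^ j) := by
  simp [x, y]

theorem y_pow_a : X.y ^ X.a =
    -(∑ j ∈ Finset.range X.a, ∑ i ∈ Finset.range X.b,
      if X.a * i + X.b * j < X.a * X.b then X.c i j • (X.x ^ i * X.y ^ j) else 0) -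
    X.d • X.x ^ X.b := by
  have hpoly : X.y ^ X.a + AdjoinRoot.mk X.poly X.tail = 0 := by
    rw [y, ← AdjoinRoot.mk_X, ← map_pow, ← map_add, ← poly, AdjoinRoot.mk_self]
  rw [eq_neg_of_add_eq_zero_left hpoly, tail, map_add, neg_add, ← sub_eq_add_neg, map_sum]
  congr 2
  · refine Finset.sum_congr rfl fun j _ => ?_
    rw [map_sum]
    refine Finset.sum_congr rfl fun i _ => ?_
    rw [apply_ite (AdjoinRoot.mk X.poly), map_zero]
    congr 1
    rw [← const_mul, x_pow_mul_y_pow, const, ← AdjoinRoot.mk_C, ← map_mul, C_mul, mul_assoc]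
  · rw [← const_mul, const, x, AdjoinRoot.mk_C, map_mul, map_pow]

theorem x_pow_mul_y_pow_add_a (i k : ℕ) : X.x ^ i * X.y ^ (X.a + k) =
    (-X.d) • (X.x ^ (i + X.b) * X.y ^ k) -
      ∑ j ∈ Finset.range X.a, ∑ i' ∈ Finset.range X.b,
        if X.a * i' + X.b * j < X.a * X.b then
          X.c i' j • (X.x ^ (i + i') * X.y ^ (k + j)) else 0 := by
  have hsum : (X.x ^ i * X.y ^ k) * ∑ j ∈ Finset.range X.a, ∑ i' ∈ Finset.range X.b,
      (if X.a * i' + X.b * j < X.a * X.b then X.c i' j • (X.x ^ i' * X.y ^ j) else 0) =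
      ∑ j ∈ Finset.range X.a, ∑ i' ∈ Finset.range X.b,
        if X.a * i' + X.b * j < X.a * X.b then
          X.c i' j • (X.x ^ (i + i') * X.y ^ (k + j)) else 0 := by
    simp only [Finset.mul_sum, mul_ite, mul_zero, mul_smul_comm, pow_add]
    simp only [mul_mul_mul_comm]
  rw [← hsum, show X.x ^ i * X.y ^ (X.a + k) = (X.x ^ i * X.y ^ k) * X.y ^ X.a by ring, y_pow_a,
    mul_sub, mul_neg, mul_smul_comm, neg_smul,
    show X.x ^ (i + X.b) * X.y ^ k = X.x ^ i * X.y ^ k * X.x ^ X.b by ring]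
  abel

/-- The equation of the curve replaces `y ^ a` by `-d x ^ b`, of the same weight `a b`, and terms
of smaller weight. -/
theorem hasLead_x_pow_mul_y_pow (i j : ℕ) :
    X.HasLead (X.x ^ i * X.y ^ j) (X.a * i + X.b * j) := by
  induction hN : X.a * i + X.b * j using Nat.strong_induction_on generalizing i j with
  | _ N ihN =>
  induction j using Nat.strong_induction_on generalizing i with
  | _ j ihj =>
  obtain hj | hj := lt_or_ge j X.a
  · have hphi := hasLead_phi (X := X) ⟨i, j, rfl⟩
    rwa [phi, expX_eq i hj, expY_eq i hj, hN] at hphi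
  obtain ⟨k, rfl⟩ := Nat.exists_eq_add_of_le hj
  rw [x_pow_mul_y_pow_add_a]
  have hlead : X.HasLead (X.x ^ (i + X.b) * X.y ^ k) N :=
    ihj k (Nat.lt_add_of_pos_left X.a_pos) (i + X.b) (by rw [← hN]; ring)
  refine (hlead.smul (neg_ne_zero.2 X.d_ne_zero)).sub
    (sum_mem fun j' _ => sum_mem fun i' _ => ?_)
  split_ifs with hlt
  · have hlt' : X.a * (i + i') + X.b * (k + j') < N := by
      rw [← hN]
      linarith
    exact Submodule.smul_mem _ _
      (deltaLE_mono (by omega) (ihN _ hlt' (i + i') (k + j') rfl).mem_deltaLE)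
  · exact zero_mem _

theorem hasLead_phi_mul_phi {s t : ℕ} (hs : s ∈ X.S) (ht : t ∈ X.S) :
    X.HasLead (X.phi s * X.phi t) (s + t) := by
  have h := hasLead_x_pow_mul_y_pow (X := X) (X.expX s + X.expX t) (X.expY s + X.expY t)
  rwa [mul_add, mul_add, add_add_add_comm, exp_spec hs, exp_spec ht, pow_add, pow_add,
    mul_mul_mul_comm] at h

theorem mul_mem_deltaLE {N M : ℤ} {f g : X.R} (hf : f ∈ X.deltaLE N) (hg : g ∈ X.deltaLE M) :
    f * g ∈ X.deltaLE (N + M) := by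
  have hle : X.deltaLE N * X.deltaLE M ≤ X.deltaLE (N + M) := by
    rw [deltaLE, deltaLE, Submodule.span_mul_span, Submodule.span_le]
    rintro _ ⟨_, ⟨s, hs, rfl⟩, _, ⟨t, ht, rfl⟩, rfl⟩
    have hst : ((s + t : ℕ) : ℤ) ≤ N + M := by
      push_cast
      exact add_le_add hs ht
    simpa using deltaLE_mono hst (hasLead_phi_mul_phi s.2 t.2).mem_deltaLE
  exact hle (Submodule.mul_mem_mul hf hg)

theorem HasLead.mul {f g : X.R} {s t : ℕ} (hf : X.HasLead f s) (hg : X.HasLead g t) :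
    X.HasLead (f * g) (s + t) := by
  have hsplit : f * g = (X.coeff f s * X.coeff g t) • (X.phi s * X.phi t) +
      ((f - X.coeff f s • X.phi s) * g +
        (X.coeff f s • X.phi s) * (g - X.coeff g t • X.phi t)) := by
    simp only [Algebra.smul_def, map_mul]
    ring
  rw [hsplit]
  refine ((hasLead_phi_mul_phi hf.mem_S hg.mem_S).smul
    (mul_ne_zero hf.coeff_ne_zero hg.coeff_ne_zero)).add (add_mem ?_ ?_)
  · exact deltaLE_mono (by push_cast; omega) (mul_mem_deltaLE hf.sub_mem_deltaLE hg.mem_deltaLE)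
  · exact deltaLE_mono (by push_cast; omega) (mul_mem_deltaLE
      (Submodule.smul_mem _ _ (hasLead_phi hf.mem_S).mem_deltaLE) hg.sub_mem_deltaLE)

theorem le_delta {f : X.R} {t : ℕ} (ht : t ∈ X.S) (h : X.coeff f t ≠ 0) : t ≤ X.delta f := by
  have hY : X.expY t ∈ (X.normalForm f).support := by
    rw [mem_support_iff]
    intro h0
    exact h (by rw [coeff, h0, Polynomial.coeff_zero])
  calc t = X.a * X.expX t + X.b * X.expY t := (exp_spec ht).symm
    _ ≤ ((X.normalForm f).coeff (X.expY t)).support.sup fun i => X.a * i + X.b * X.expY t :=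
      Finset.le_sup (f := fun i => X.a * i + X.b * X.expY t) (mem_support_iff.2 h)
    _ ≤ X.delta f :=
      Finset.le_sup (f := fun j => ((X.normalForm f).coeff j).support.sup
        fun i => X.a * i + X.b * j) hY

theorem exists_delta_eq {f : X.R} (hf : f ≠ 0) :
    ∃ i j, ((X.normalForm f).coeff j).coeff i ≠ 0 ∧ X.delta f = X.a * i + X.b * j := by
  have hne : (X.normalForm f).support.Nonempty := by
    rw [support_nonempty]
    intro h
    exact hf (by rw [← AdjoinRoot.mk_leftInverse X.monic_poly f, ← normalForm, h, map_zero])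
  obtain ⟨j, hj, hsupj⟩ := Finset.exists_mem_eq_sup _ hne fun j =>
    ((X.normalForm f).coeff j).support.sup fun i => X.a * i + X.b * j
  obtain ⟨i, hi, hsupi⟩ := Finset.exists_mem_eq_sup _
    (support_nonempty.2 (mem_support_iff.1 hj)) fun i => X.a * i + X.b * j
  exact ⟨i, j, mem_support_iff.1 hi, by rw [delta, hsupj, hsupi]⟩

theorem lt_a_of_coeff_normalForm_ne_zero {f : X.R} {j : ℕ} (h : (X.normalForm f).coeff j ≠ 0) :
    j < X.a := by
  obtain ⟨p, rfl⟩ := AdjoinRoot.mk_surjective f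
  rw [← natDegree_poly, ← Nat.cast_lt (α := WithBot ℕ), ← degree_eq_natDegree X.monic_poly.ne_zero]
  exact (le_degree_of_ne_zero h).trans_lt (degree_modByMonic_lt p X.monic_poly)

theorem hasLead_delta {f : X.R} (hf : f ≠ 0) : X.HasLead f (X.delta f) := by
  have hle : f ∈ X.deltaLE (X.delta f) :=
    mem_deltaLE.2 fun t ht h => by exact_mod_cast le_delta ht h
  obtain ⟨i, j, hij, hdelta⟩ := exists_delta_eq hf
  have hj : j < X.a := lt_a_of_coeff_normalForm_ne_zero (f := f) fun h0 => hij (by simp [h0])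
  refine ⟨⟨i, j, hdelta⟩, ?_, hle⟩
  rwa [coeff, hdelta, expX_eq i hj, expY_eq i hj]

theorem hasLead_iff {f : X.R} {t : ℕ} : X.HasLead f t ↔ f ≠ 0 ∧ X.delta f = t :=
  ⟨fun h => ⟨h.ne_zero, (hasLead_delta h.ne_zero).unique h⟩,
    fun h => h.2 ▸ hasLead_delta h.1⟩

theorem HasLead.delta_eq {f : X.R} {t : ℕ} (h : X.HasLead f t) : X.delta f = t :=
  (hasLead_iff.1 h).2

section Evaluation

/-! ### Evaluation at points -/

theorem algHom_ext_x_y {A : Type*} [Semiring A] [Algebra F A] {f g : X.R →ₐ[F] A}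
    (hx : f X.x = g X.x) (hy : f X.y = g X.y) : f = g := by
  refine AlgHom.toLinearMap_injective (X.phiBasis.ext fun s => ?_)
  simp [phi, hx, hy]

/-- Evaluation at a point, as a homomorphism of `F`-algebras. -/
def evalHom (p : X.Point) : X.R →ₐ[F] F where
  __ := AdjoinRoot.evalEval p.2
  commutes' c := (AdjoinRoot.evalEval_mk p.2 (C (C c))).trans (by simp [evalEval])

theorem evalHom_x (p : X.Point) : evalHom p X.x = p.1.1 :=
  (AdjoinRoot.evalEval_mk p.2 (C Polynomial.X)).trans (by simp [evalEval])

theorem evalHom_y (p : X.Point) : evalHom p X.y = p.1.2 :=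
  (AdjoinRoot.evalEval_mk p.2 Polynomial.X).trans (by simp [evalEval])

theorem evalHom_const (p : X.Point) (c : F) : evalHom p (X.const c) = c :=
  (evalHom p).commutes c

theorem ker_evalHom (p : X.Point) : RingHom.ker (evalHom p) = X.maxIdeal p := by
  refine le_antisymm (fun f hf => ?_) (Ideal.span_le.2 ?_)
  · have hmk : Ideal.Quotient.mkₐ F (X.maxIdeal p) =
        (Algebra.ofId F (X.R ⧸ X.maxIdeal p)).comp (evalHom p) := by
      refine algHom_ext_x_y ?_ ?_
      · rw [AlgHom.comp_apply, evalHom_x]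
        exact Ideal.Quotient.eq.2 (Ideal.subset_span (Or.inl rfl))
      · rw [AlgHom.comp_apply, evalHom_y]
        exact Ideal.Quotient.eq.2 (Ideal.subset_span (Or.inr rfl))
    have hf' := DFunLike.congr_fun hmk f
    rw [AlgHom.comp_apply, (RingHom.mem_ker).1 hf, map_zero] at hf'
    exact Ideal.Quotient.eq_zero_iff_mem.1 hf'
  · rintro g (rfl | rfl)
    · simp [evalHom_x, evalHom_const]
    · simp [evalHom_y, evalHom_const]

theorem maxIdeal_isMaximal (p : X.Point) : (X.maxIdeal p).IsMaximal :=
  ker_evalHom p ▸ RingHom.ker_isMaximal_of_surjective (evalHom p)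
    fun c => ⟨X.const c, evalHom_const p c⟩

theorem maxIdeal_injective : Function.Injective X.maxIdeal := by
  intro p q h
  have hx : X.x - X.const p.1.1 ∈ X.maxIdeal q := h ▸ Ideal.subset_span (by simp)
  have hy : X.y - X.const p.1.2 ∈ X.maxIdeal q := h ▸ Ideal.subset_span (by simp)
  rw [← ker_evalHom, RingHom.mem_ker, map_sub, evalHom_const, sub_eq_zero] at hx hy
  rw [evalHom_x] at hx
  rw [evalHom_y] at hy
  exact Subtype.ext (Prod.ext hx.symm hy.symm)

variable {ι : Type*}

/-- Evaluation at a family of points. -/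
def evalPi (P : ι → X.Point) : X.R →ₐ[F] (ι → F) := AlgHom.pi fun i => evalHom (P i)

theorem evalPi_surjective [Finite ι] (P : ι ↪ X.Point) : Function.Surjective (evalPi P) := by
  have hcoprime : Pairwise (Function.onFun IsCoprime fun i => X.maxIdeal (P i)) := by
    intro i j hij
    have := maxIdeal_isMaximal (P i)
    have := maxIdeal_isMaximal (P j)
    exact Ideal.isCoprime_of_isMaximal (maxIdeal_injective.ne (P.injective.ne hij))
  intro v
  obtain ⟨f, hf⟩ := Ideal.exists_forall_sub_mem_ideal hcoprime fun i => X.const (v i)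
  refine ⟨f, funext fun i => ?_⟩
  have hfi := hf i
  rw [← ker_evalHom, RingHom.mem_ker, map_sub, evalHom_const, sub_eq_zero] at hfi
  exact hfi

/-- The ideal of the functions that vanish at a family of points. -/
def vanishing (P : ι → X.Point) : Ideal X.R := ⨅ i, X.maxIdeal (P i)

theorem mem_vanishing {P : ι → X.Point} {f : X.R} :
    f ∈ vanishing P ↔ ∀ i, evalHom (P i) f = 0 := by
  simp [vanishing, Submodule.mem_iInf, ← ker_evalHom]

theorem ker_evalPi (P : ι → X.Point) :
    LinearMap.ker (evalPi P).toLinearMap = (vanishing P).restrictScalars F := by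
  ext f
  simp [mem_vanishing, evalPi, funext_iff]

/-! ### Footprints of ideals -/

theorem mem_sigma {I : Ideal X.R} {t : ℕ} : t ∈ X.sigma I ↔ ∃ f ∈ I, X.HasLead f t := by
  simp only [sigma, Set.mem_ofPred_eq, hasLead_iff]

theorem Delta_antitone {I I' : Ideal X.R} (h : I ≤ I') : X.Delta I' ⊆ X.Delta I :=
  Set.sdiff_subset_sdiff_right fun _ ⟨f, hf, hlead⟩ => ⟨f, h hf, hlead⟩

theorem isLeadIndex_phiBasis {f : X.R} {t : X.S} :
    IsLeadIndex X.phiBasis (fun s : X.S => (s : ℕ)) f t ↔ X.HasLead f t := by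
  simp only [IsLeadIndex, HasLead, mem_deltaLE, phiBasis_repr, Subtype.forall, Nat.cast_le, t.2,
    true_and]

theorem Delta_eq_image_standardIndices (I : Ideal X.R) :
    X.Delta I = (fun s : X.S => (s : ℕ)) ''
      standardIndices X.phiBasis (fun s : X.S => (s : ℕ)) (I.restrictScalars F) := by
  ext t
  simp only [Delta, Set.mem_sdiff, mem_sigma, not_exists, not_and, Set.mem_image, standardIndices,
    Set.mem_ofPred_eq, isLeadIndex_phiBasis, Subtype.exists, exists_and_right, exists_eq_right,
    exists_prop, Submodule.restrictScalars_mem]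

theorem finite_Delta_vanishing [Finite ι] (P : ι ↪ X.Point) : (X.Delta (vanishing P)).Finite := by
  rw [Delta_eq_image_standardIndices, ← ker_evalPi]
  exact (finite_standardIndices_ker Subtype.val_injective (evalPi_surjective P)).image _

theorem ncard_Delta_vanishing [Fintype ι] (P : ι ↪ X.Point) :
    (X.Delta (vanishing P)).ncard = Fintype.card ι := by
  rw [Delta_eq_image_standardIndices, ← ker_evalPi,
    Set.ncard_image_of_injective _ Subtype.val_injective,
    ncard_standardIndices_ker Subtype.val_injective (evalPi_surjective P),
    Module.finrank_fintype_fun_eq_card]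

theorem mem_Delta_span_phi {s t : ℕ} (hs : s ∈ X.S) :
    t ∈ X.Delta (Ideal.span {X.phi s}) ↔ t ∈ X.S ∧ ¬ X.Dvd s t := by
  rw [Delta, Set.mem_sdiff, mem_sigma]
  refine and_congr_right fun ht => not_congr ⟨?_, ?_⟩
  · rintro ⟨f, hf, hlead⟩
    obtain ⟨g, rfl⟩ := Ideal.mem_span_singleton.1 hf
    have hg := hasLead_delta (right_ne_zero_of_mul hlead.ne_zero)
    exact ⟨X.delta g, hg.mem_S, hlead.unique ((hasLead_phi hs).mul hg)⟩
  · rintro ⟨r, hr, rfl⟩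
    exact ⟨X.phi s * X.phi r, Ideal.mul_mem_right _ _ (Ideal.mem_span_singleton_self _),
      hasLead_phi_mul_phi hs hr⟩

theorem Delta_subset_Delta_span_phi {I : Ideal X.R} {f : X.R} (hf : f ∈ I) {t : ℕ}
    (hlead : X.HasLead f t) : X.Delta I ⊆ X.Delta (Ideal.span {X.phi t}) := by
  rintro r ⟨hr, hrI⟩
  refine (mem_Delta_span_phi hlead.mem_S).2 ⟨hr, ?_⟩
  rintro ⟨q, hq, rfl⟩
  exact hrI (mem_sigma.2 ⟨f * X.phi q, I.mul_mem_right _ hf, hlead.mul (hasLead_phi hq)⟩)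

theorem add_mul_notMem_Delta_span_phi {s : ℕ} (hs : s ∈ X.S) :
    ∀ t ∈ X.Delta (Ideal.span {X.phi s}), ∀ k,
      t + s * (k + 1) ∉ X.Delta (Ideal.span {X.phi s}) := by
  intro t ht k htk
  exact ((mem_Delta_span_phi hs).1 htk).2
    ⟨t + s * k, add_mem_S ht.1 (mul_mem_S hs k), by ring⟩

theorem finite_Delta_span_phi {s : ℕ} (hs : s ∈ X.S) :
    (X.Delta (Ideal.span {X.phi s})).Finite :=
  finite_of_forall_add_mul_notMem (add_mul_notMem_Delta_span_phi hs)

theorem ncard_Delta_span_phi_le {s : ℕ} (hs : s ∈ X.S) :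
    (X.Delta (Ideal.span {X.phi s})).ncard ≤ s :=
  ncard_le_of_forall_add_mul_notMem (add_mul_notMem_Delta_span_phi hs)

/-! ### The numbers `ν(s)` and `d_u` -/

variable {n : ℕ} (P : Fin n ↪ X.Point)

theorem finite_Delta_J : (X.Delta (X.J P)).Finite := finite_Delta_vanishing P

theorem ncard_Delta_J : (X.Delta (X.J P)).ncard = n :=
  (ncard_Delta_vanishing P).trans (Fintype.card_fin n)

theorem sub_le_nu {s : ℕ} (hs : s ∈ X.S) : (n : ℤ) - s ≤ X.nu P s := by
  have h := Set.ncard_le_ncard (Set.subset_union_left (s := X.Delta (X.J P))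
    (t := X.Delta (Ideal.span {X.phi s}))) ((finite_Delta_J P).union (finite_Delta_span_phi hs))
  rw [ncard_Delta_J] at h
  rw [nu]
  omega

theorem nu_add_ncard_inter_le {s : ℕ} (hs : s ∈ X.S) :
    X.nu P s + (X.Delta (X.J P) ∩ X.Delta (Ideal.span {X.phi s})).ncard ≤ n := by
  have h := Set.ncard_union_add_ncard_inter (X.Delta (X.J P)) (X.Delta (Ideal.span {X.phi s}))
    (finite_Delta_J P) (finite_Delta_span_phi hs)
  have hle := ncard_Delta_span_phi_le hs
  rw [ncard_Delta_J] at h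
  rw [nu]
  omega

theorem mem_nongapsLE {u s : ℕ} : s ∈ X.nongapsLE u ↔ s ∈ X.S ∧ s ≤ u := by
  simp only [nongapsLE, Finset.mem_filter, Finset.mem_range, Nat.lt_succ_iff]
  exact and_comm

theorem du_le_nu {u s : ℕ} (hs : s ∈ X.S) (hsu : s ≤ u) : X.du P u ≤ X.nu P s :=
  Finset.inf'_le _ (mem_nongapsLE.2 ⟨hs, hsu⟩)

theorem sub_le_du (u : ℕ) : (n : ℤ) - u ≤ X.du P u := by
  refine Finset.le_inf' _ _ fun s hs => ?_
  obtain ⟨hs, hsu⟩ := mem_nongapsLE.1 hs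
  exact le_trans (by gcongr) (sub_le_nu P hs)

/-- The ideal of the functions that vanish at the points where the vector `e` is zero, the
error-free points if `e` is the error. -/
def zeroIdeal (e : Fin n → F) : Ideal X.R := vanishing fun i : {i // e i = 0} => P i

variable {P}

theorem mem_zeroIdeal {e : Fin n → F} {f : X.R} :
    f ∈ zeroIdeal P e ↔ ∀ i, e i = 0 → evalHom (P i) f = 0 := by
  simp [zeroIdeal, mem_vanishing]

theorem Delta_zeroIdeal_subset (e : Fin n → F) : X.Delta (zeroIdeal P e) ⊆ X.Delta (X.J P) :=
  Delta_antitone fun _ hf => mem_zeroIdeal.2 fun i _ => mem_vanishing.1 hf i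

theorem ncard_Delta_zeroIdeal_add_hammingNorm [DecidableEq F] (e : Fin n → F) :
    (X.Delta (zeroIdeal P e)).ncard + hammingNorm e = n := by
  have hcard := Finset.card_filter_add_card_filter_not (s := Finset.univ) fun i => e i = 0
  rw [Finset.card_univ, Fintype.card_fin] at hcard
  have hDelta := ncard_Delta_vanishing ((Function.Embedding.subtype fun i => e i = 0).trans P)
  rw [Fintype.card_subtype] at hDelta
  exact (congrArg (· + hammingNorm e) hDelta).trans hcard

theorem nu_le_hammingNorm_ev [DecidableEq F] {f : X.R} {t : ℕ} (hf : X.HasLead f t) :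
    X.nu P t ≤ hammingNorm (X.ev P f) := by
  have hsubset : X.Delta (zeroIdeal P (X.ev P f)) ⊆
      X.Delta (X.J P) ∩ X.Delta (Ideal.span {X.phi t}) :=
    Set.subset_inter (Delta_zeroIdeal_subset _)
      (Delta_subset_Delta_span_phi (mem_zeroIdeal.2 fun _ hi => hi) hf)
  have hle := Set.ncard_le_ncard hsubset ((finite_Delta_J P).inter_of_left _)
  have hzero := ncard_Delta_zeroIdeal_add_hammingNorm (P := P) (X.ev P f)
  have hnu := nu_add_ncard_inter_le P hf.mem_S
  omega

/-! ### Existence of initial states -/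

theorem exists_minimal_dvd (T : Set ℕ) {t : ℕ} (ht : t ∈ T) :
    ∃ m ∈ T, X.Dvd m t ∧ ∀ m' ∈ T, X.Dvd m' m → m' = m := by
  induction t using Nat.strong_induction_on with
  | _ t ih =>
  by_cases hmin : ∀ m' ∈ T, X.Dvd m' t → m' = t
  · exact ⟨t, ht, Dvd.refl t, hmin⟩
  · push Not at hmin
    obtain ⟨t', ht', hdvd, hne⟩ := hmin
    obtain ⟨m, hm, hmt', hmmin⟩ := ih t' (hdvd.le.lt_of_ne hne) ht'
    exact ⟨m, hm, hmt'.trans hdvd, hmmin⟩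

theorem exists_finite_isGroebnerBasis (I : Ideal X.R) :
    ∃ η : Set X.R, η.Finite ∧ X.IsGroebnerBasis I η := by
  set T := {t | t ∈ X.sigma I ∧ ∀ t' ∈ X.sigma I, X.Dvd t' t → t' = t}
  have hT : T.Finite := by
    refine finite_of_forall_add_mul_notMem (m := X.a) fun t ht k htk => ?_
    have heq := htk.2 t ht.1 ⟨X.a * (k + 1), mul_mem_S a_mem_S _, rfl⟩
    have hpos : 0 < X.a * (k + 1) := Nat.mul_pos X.a_pos k.succ_pos
    omega
  have hlead : ∀ t ∈ T, ∃ f ∈ I, X.HasLead f t := fun t ht => mem_sigma.1 ht.1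
  choose! g hgI hg using hlead
  refine ⟨g '' T, hT.image g, ?_, fun f hf hf0 => ?_⟩
  · rintro _ ⟨t, ht, rfl⟩
    exact ⟨hgI t ht, (hg t ht).ne_zero⟩
  · obtain ⟨m, hm, hdvd, hmin⟩ := exists_minimal_dvd (X := X) (X.sigma I) ⟨f, hf, hf0, rfl⟩
    exact ⟨g m, ⟨m, ⟨hm, hmin⟩, rfl⟩, by rwa [(hg m ⟨hm, hmin⟩).delta_eq]⟩

theorem exists_isInit (v : Fin n → F) : ∃ σ, X.IsInit P v σ := by
  obtain ⟨h, hh⟩ := evalPi_surjective P v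
  obtain ⟨η, hη, hbasis⟩ := exists_finite_isGroebnerBasis (X.J P)
  by_cases h0 : h = 0
  · exact ⟨⟨-1, _, 0⟩, h, η, hh, hη, hbasis, rfl, Or.inl ⟨h0, rfl⟩, rfl⟩
  · exact ⟨⟨X.delta h, _, 0⟩, h, η, hh, hη, hbasis, rfl, Or.inr ⟨h0, rfl⟩, rfl⟩

end Evaluation

section ModuleOrder

/-! ### Leading monomials in `R z ⊕ R` -/

variable {s : ℤ} {f g : X.R × X.R} {m p q : Mono}

theorem MonoDvd.refl (m : Mono) : X.MonoDvd m m := by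
  rcases m with t | t <;> exact Dvd.refl t

theorem MonoDvd.trans (hmp : X.MonoDvd m p) (hpq : X.MonoDvd p q) : X.MonoDvd m q := by
  rcases m with t | t <;> rcases p with t' | t' <;> rcases q with t'' | t'' <;>
    first | exact Dvd.trans hmp hpq | exact hmp.elim | exact hpq.elim

theorem exists_minimal_monoDvd (T : Set Mono) (hm : m ∈ T) :
    ∃ p ∈ T, X.MonoDvd p m ∧ ∀ q ∈ T, X.MonoDvd q p → q = p := by
  rcases m with t | t
  · obtain ⟨r, hr, hrt, hmin⟩ := exists_minimal_dvd (X := X) (Mono.up ⁻¹' T) hm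
    refine ⟨.up r, hr, hrt, ?_⟩
    rintro (r' | r') hr' hdvd
    exacts [congrArg _ (hmin r' hr' hdvd), hdvd.elim]
  · obtain ⟨r, hr, hrt, hmin⟩ := exists_minimal_dvd (X := X) (Mono.down ⁻¹' T) hm
    refine ⟨.down r, hr, hrt, ?_⟩
    rintro (r' | r') hr' hdvd
    exacts [hdvd.elim, congrArg _ (hmin r' hr' hdvd)]

theorem isLM_up {t : ℕ} :
    X.IsLM s f (.up t) ↔ X.HasLead f.1 t ∧ f.2 ∈ X.deltaLE (t + s) := by
  simp only [IsLM, supp, Set.mem_ofPred_eq, HasLead, mem_deltaLE, and_assoc]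
  refine and_congr_right fun _ => and_congr_right fun _ => ⟨fun h => ⟨fun r hr hne => ?_,
    fun r hr hne => ?_⟩, ?_⟩
  · simpa [Mono.le, Mono.weight, Mono.zdeg, le_iff_lt_or_eq] using h (.up r) ⟨hr, hne⟩
  · simpa [Mono.le, Mono.weight, Mono.zdeg, le_iff_lt_or_eq] using h (.down r) ⟨hr, hne⟩
  · rintro ⟨hup, hdown⟩ (r | r) ⟨hr, hne⟩
    · simpa [Mono.le, Mono.weight, Mono.zdeg, le_iff_lt_or_eq] using hup r hr hne
    · simpa [Mono.le, Mono.weight, Mono.zdeg, le_iff_lt_or_eq] using hdown r hr hne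

theorem isLM_down {t : ℕ} :
    X.IsLM s f (.down t) ↔ X.HasLead f.2 t ∧ f.1 ∈ X.deltaLE (t - s - 1) := by
  simp only [IsLM, supp, Set.mem_ofPred_eq, HasLead, mem_deltaLE, and_assoc]
  refine and_congr_right fun _ => and_congr_right fun _ => ⟨fun h => ⟨fun r hr hne => ?_,
    fun r hr hne => ?_⟩, ?_⟩
  · simpa [Mono.le, Mono.weight, Mono.zdeg, le_iff_lt_or_eq] using h (.down r) ⟨hr, hne⟩
  · have hle : (r : ℤ) + s < t := by
      simpa [Mono.le, Mono.weight, Mono.zdeg] using h (.up r) ⟨hr, hne⟩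
    omega
  · rintro ⟨hdown, hup⟩ (r | r) ⟨hr, hne⟩
    · have hle := hup r hr hne
      exact Or.inl (show (r : ℤ) + s < t by omega)
    · simpa [Mono.le, Mono.weight, Mono.zdeg, le_iff_lt_or_eq] using hdown r hr hne

theorem IsLM.unique (h : X.IsLM s f m) (h' : X.IsLM s f p) : m = p :=
  Mono.le_antisymm (h'.2 m h.1) (h.2 p h'.1)

theorem IsLM.idx_mem_S (h : X.IsLM s f m) : m.idx ∈ X.S := h.1.1

theorem IsLM.exists_smul (h : X.IsLM s f p) (hdvd : X.MonoDvd p m) :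
    ∃ c : X.R, X.IsLM s (c • f) m := by
  rcases p with t | t <;> rcases m with r | r <;> try exact hdvd.elim
  · obtain ⟨q, hq, rfl⟩ := hdvd
    obtain ⟨hlead, hlow⟩ := isLM_up.1 h
    exact ⟨X.phi q, isLM_up.2 ⟨add_comm t q ▸ (hasLead_phi hq).mul hlead,
      deltaLE_mono (by push_cast; omega) (mul_mem_deltaLE (hasLead_phi hq).mem_deltaLE hlow)⟩⟩
  · obtain ⟨q, hq, rfl⟩ := hdvd
    obtain ⟨hlead, hlow⟩ := isLM_down.1 h
    exact ⟨X.phi q, isLM_down.2 ⟨add_comm t q ▸ (hasLead_phi hq).mul hlead,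
      deltaLE_mono (by push_cast; omega) (mul_mem_deltaLE (hasLead_phi hq).mem_deltaLE hlow)⟩⟩

theorem DeltaGen₂_antitone {B B' : Set (X.R × X.R)} (h : B ⊆ B') :
    X.DeltaGen₂ s B' ⊆ X.DeltaGen₂ s B :=
  fun _ hm => ⟨hm.1, fun g hg => hm.2 g (h hg)⟩

theorem IsLM.notMem_DeltaGen₂ {B : Set (X.R × X.R)} (h : X.IsLM s f m) (hf : f ∈ B) :
    m ∉ X.DeltaGen₂ s B :=
  fun hm => hm.2 f hf m h (MonoDvd.refl m)

theorem notMem_DeltaGen₂_iff {B : Set (X.R × X.R)} (hm : m.idx ∈ X.S) :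
    m ∉ X.DeltaGen₂ s B ↔ ∃ g ∈ B, ∃ p, X.IsLM s g p ∧ X.MonoDvd p m := by
  simp [DeltaGen₂, hm]

theorem DeltaGen_image_snd_downPart (B : Set (X.R × X.R)) :
    X.DeltaGen (Prod.snd '' X.downPart s B) = Mono.down ⁻¹' X.DeltaGen₂ s B := by
  ext t
  refine and_congr_right fun _ => ⟨fun h f hf p hp hdvd => ?_, ?_⟩
  · rcases p with p | p
    · exact hdvd
    · have hlead := (isLM_down.1 hp).1
      exact h ⟨f.2, ⟨f, ⟨hf, p, hp⟩, rfl⟩, hlead.ne_zero, by rwa [hlead.delta_eq]⟩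
  · rintro h ⟨_, ⟨f, ⟨hf, p, hp⟩, rfl⟩, -, hdvd⟩
    rw [(isLM_down.1 hp).1.delta_eq] at hdvd
    exact h f hf _ hp hdvd

variable (X) in
/-- Monomials of `R z ⊕ R` are monomials of the two summands. -/
def monoEquiv : X.S ⊕ X.S ≃ {m : Mono // m.idx ∈ X.S} where
  toFun := Sum.elim (fun t => ⟨.up t, t.2⟩) (fun t => ⟨.down t, t.2⟩)
  invFun
    | ⟨.up t, ht⟩ => .inl ⟨t, ht⟩
    | ⟨.down t, ht⟩ => .inr ⟨t, ht⟩
  left_inv := by rintro (t | t) <;> rfl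
  right_inv := by rintro ⟨t | t, ht⟩ <;> rfl

variable (X) in
/-- The `F`-basis of `R z ⊕ R` that consists of the monomials. -/
def monoBasis : Module.Basis {m : Mono // m.idx ∈ X.S} F (X.R × X.R) :=
  (X.phiBasis.prod X.phiBasis).reindex X.monoEquiv

theorem monoBasis_repr (f : X.R × X.R) (m : {m : Mono // m.idx ∈ X.S}) :
    X.monoBasis.repr f m = X.coeff₂ f m := by
  rw [monoBasis, Module.Basis.repr_reindex_apply]
  obtain ⟨t | t, ht⟩ := m
  · exact (Module.Basis.prod_repr_inl _ _ _ _).trans (phiBasis_repr _ _)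
  · exact (Module.Basis.prod_repr_inr _ _ _ _).trans (phiBasis_repr _ _)

theorem isLeadIndex_monoBasis {k : ℕ} {m : {m : Mono // m.idx ∈ X.S}} :
    IsLeadIndex X.monoBasis (fun m => m.1.rank k) f m ↔ X.IsLM k f m := by
  simp only [IsLeadIndex, monoBasis_repr, IsLM, supp, Set.mem_ofPred_eq, m.2, true_and, and_imp,
    Subtype.forall, Mono.le_iff_rank_le]

theorem exists_isLM (k : ℤ) (hf : f ≠ 0) : ∃ m, X.IsLM k f m := by
  by_cases h1 : f.1 = 0
  · have h2 : f.2 ≠ 0 := fun h2 => hf (Prod.ext h1 h2)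
    exact ⟨_, isLM_down.2 ⟨hasLead_delta h2, h1 ▸ zero_mem _⟩⟩
  by_cases h2 : f.2 = 0
  · exact ⟨_, isLM_up.2 ⟨hasLead_delta h1, h2 ▸ zero_mem _⟩⟩
  obtain hle | hlt := le_or_gt (X.delta f.2 : ℤ) (X.delta f.1 + k)
  · exact ⟨_, isLM_up.2 ⟨hasLead_delta h1, deltaLE_mono hle (hasLead_delta h2).mem_deltaLE⟩⟩
  · exact ⟨_, isLM_down.2
      ⟨hasLead_delta h2, deltaLE_mono (by omega) (hasLead_delta h1).mem_deltaLE⟩⟩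

/-! ### The interpolation module -/

variable {n : ℕ} (P : Fin n ↪ X.Point) (r : Fin n → F)

/-- The values at the points of `f ∈ R z ⊕ R` for `z = r`. -/
def interpEval : X.R × X.R →ₗ[F] (Fin n → F) :=
  (LinearMap.mulRight F r ∘ₗ (evalPi P).toLinearMap).coprod (evalPi P).toLinearMap

theorem interpEval_apply (f : X.R × X.R) :
    interpEval P r f = evalPi P f.1 * r + evalPi P f.2 := by
  simp [interpEval]

theorem interpEval_surjective : Function.Surjective (interpEval P r) := by
  intro v
  obtain ⟨f, hf⟩ := evalPi_surjective P v
  exact ⟨(0, f), by simp [interpEval_apply, hf]⟩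

/-- The interpolation module: the `f ∈ R z ⊕ R` that vanish at the points for `z = r`. -/
def interp : Submodule X.R (X.R × X.R) where
  __ := LinearMap.ker (interpEval P r)
  smul_mem' c f hf := by
    have hf : evalPi P f.1 * r + evalPi P f.2 = 0 := (interpEval_apply P r f).symm.trans hf
    change interpEval P r (c • f) = 0
    rw [interpEval_apply, Prod.smul_fst, Prod.smul_snd, smul_eq_mul, smul_eq_mul, map_mul, map_mul,
      mul_assoc, ← mul_add, hf, mul_zero]

variable {P r}

theorem mem_interp : f ∈ interp P r ↔ evalPi P f.1 * r + evalPi P f.2 = 0 := by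
  rw [← interpEval_apply]
  rfl

theorem DeltaGen₂_interp_eq_image_standardIndices (k : ℕ) :
    X.DeltaGen₂ k (interp P r) = Subtype.val ''
      standardIndices X.monoBasis (fun m => m.1.rank k) (LinearMap.ker (interpEval P r)) := by
  ext m
  refine ⟨fun hm => ⟨⟨m, hm.1⟩, fun f hf hlead => ?_, rfl⟩, ?_⟩
  · exact (isLeadIndex_monoBasis.1 hlead).notMem_DeltaGen₂ hf hm
  · rintro ⟨m, hm, rfl⟩
    refine ⟨m.2, fun f hf p hp hdvd => ?_⟩
    obtain ⟨c, hc⟩ := hp.exists_smul hdvd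
    exact hm (c • f) ((interp P r).smul_mem c hf) (isLeadIndex_monoBasis.2 hc)

theorem ncard_DeltaGen₂_interp (k : ℕ) : (X.DeltaGen₂ k (interp P r)).ncard = n := by
  have hrank : Function.Injective fun m : {m : Mono // m.idx ∈ X.S} => m.1.rank k :=
    (Mono.rank_injective k).comp Subtype.val_injective
  rw [DeltaGen₂_interp_eq_image_standardIndices,
    Set.ncard_image_of_injective _ Subtype.val_injective,
    ncard_standardIndices_ker hrank (interpEval_surjective P r), Module.finrank_fintype_fun_eq_card,
    Fintype.card_fin]

theorem DeltaGen₂_eq_DeltaGen₂_interp {k : ℕ} {B : Set (X.R × X.R)} (hB : B ⊆ interp P r)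
    (hfin : (X.DeltaGen₂ k B).Finite) (hcard : (X.DeltaGen₂ k B).ncard ≤ n) :
    X.DeltaGen₂ k B = X.DeltaGen₂ k (interp P r) :=
  (Set.eq_of_subset_of_ncard_le (DeltaGen₂_antitone hB)
    (hcard.trans_eq (ncard_DeltaGen₂_interp k).symm) hfin).symm

end ModuleOrder

section Update

/-! ### Step M2 -/

variable {f g : X.R × X.R} {B B' G A : Set (X.R × X.R)} {k t r p l : ℕ}

theorem IsLM.pred_down {s : ℤ} (hf : X.IsLM s f (.down t)) : X.IsLM (s - 1) f (.down t) := by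
  rw [isLM_down] at hf ⊢
  exact ⟨hf.1, deltaLE_mono (by omega) hf.2⟩

theorem IsLM.pred_up (hf : X.IsLM k f (.up t)) :
    X.IsLM (k - 1) f (.up t) ∨ X.IsLM (k - 1) f (.down (t + k)) := by
  obtain ⟨hlead, hlow⟩ := isLM_up.1 hf
  obtain ⟨m, hm⟩ := exists_isLM ((k : ℤ) - 1) fun h0 : f = 0 => hlead.ne_zero (by rw [h0]; rfl)
  rcases m with r | r
  · exact Or.inl (hlead.unique (isLM_up.1 hm).1 ▸ hm)
  · obtain ⟨hlead', hlow'⟩ := isLM_down.1 hm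
    have hle := mem_deltaLE.1 hlow r hlead'.mem_S hlead'.coeff_ne_zero
    have hge := mem_deltaLE.1 hlow' t hlead.mem_S hlead.coeff_ne_zero
    obtain rfl : r = t + k := by omega
    exact Or.inr hm

theorem IsLM.eq_add_of_pred_down (hf : X.IsLM k f (.up t)) (hf' : X.IsLM (k - 1) f (.down r)) :
    r = t + k := by
  rcases hf.pred_up with h | h
  · cases hf'.unique h
  · exact Mono.down.inj (hf'.unique h)

theorem quotTerm_eq {g : X.R} {q : ℕ} (hg : X.HasLead g t) (hq : q ∈ X.S) :
    X.quotTerm (t + q) g = (X.coeff (X.phi q * g) (t + q))⁻¹ • X.phi q := by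
  have hlead : X.HasLead (X.phi q * g) (t + q) := add_comm q t ▸ (hasLead_phi hq).mul hg
  rw [quotTerm, hg.delta_eq, Nat.add_sub_cancel_left, lc, hlead.delta_eq, const_mul]

theorem hasLead_quotTerm {g : X.R} (hg : X.HasLead g t) (hdvd : X.Dvd t l) :
    X.HasLead (X.quotTerm l g) (l - t) := by
  obtain ⟨q, hq, rfl⟩ := hdvd
  have hlead : X.HasLead (X.phi q * g) (t + q) := add_comm q t ▸ (hasLead_phi hq).mul hg
  rw [quotTerm_eq hg hq, Nat.add_sub_cancel_left]
  exact (hasLead_phi hq).smul (inv_ne_zero hlead.coeff_ne_zero)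

theorem coeff_quotTerm_mul {g : X.R} (hg : X.HasLead g t) (hdvd : X.Dvd t l) :
    X.coeff (X.quotTerm l g * g) l = 1 := by
  obtain ⟨q, hq, rfl⟩ := hdvd
  have hlead : X.HasLead (X.phi q * g) (t + q) := add_comm q t ▸ (hasLead_phi hq).mul hg
  rw [quotTerm_eq hg hq, smul_mul_assoc, coeff_smul, inv_mul_cancel₀ hlead.coeff_ne_zero]

theorem scomb_snd_mem_deltaLE (hf : X.HasLead f.2 t) (hg : X.HasLead g.2 p) (ht : X.Dvd t l)
    (hp : X.Dvd p l) : (X.scomb l f g).2 ∈ X.deltaLE (l - 1) := by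
  have hf' := (hasLead_quotTerm hf ht).mul hf
  have hg' := (hasLead_quotTerm hg hp).mul hg
  rw [Nat.sub_add_cancel ht.le] at hf'
  rw [Nat.sub_add_cancel hp.le] at hg'
  refine mem_deltaLE_sub_one (sub_mem hf'.mem_deltaLE hg'.mem_deltaLE) fun r _ hr => ?_
  obtain rfl : r = l := by exact_mod_cast hr
  exact (coeff_sub _ _ _).trans
    (by rw [Prod.smul_snd, Prod.smul_snd, smul_eq_mul, smul_eq_mul, coeff_quotTerm_mul hf ht,
      coeff_quotTerm_mul hg hp, sub_self])

/-- The `z`-part of the combination comes from `f`, because `f` still has its leading monomial in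
`R z` for `>_k`, while the `z`-part of `g` is smaller. -/
theorem isLM_scomb (hf : X.IsLM k f (.up t)) (hf' : X.IsLM (k - 1) f (.down (t + k)))
    (hg : X.IsLM k g (.down p)) (ht : X.Dvd (t + k) l) (hp : X.Dvd p l) :
    X.IsLM (k - 1) (X.scomb l f g) (.up (l - k)) := by
  rw [isLM_up] at hf ⊢
  rw [isLM_down] at hf' hg
  have htl := ht.le
  have hpl := hp.le
  constructor
  · have hlead := (hasLead_quotTerm hf'.1 ht).mul hf.1
    rw [show l - (t + k) + t = l - k by omega] at hlead
    refine hlead.sub (deltaLE_mono ?_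
      (mul_mem_deltaLE (hasLead_quotTerm hg.1 hp).mem_deltaLE hg.2))
    omega
  · exact deltaLE_mono (by omega) (scomb_snd_mem_deltaLE hf'.1 hg.1 ht hp)

theorem scomb_mem {M : Submodule X.R (X.R × X.R)} (hf : f ∈ M) (hg : g ∈ M) (l : ℕ) :
    X.scomb l f g ∈ M :=
  M.sub_mem (M.smul_mem _ hf) (M.smul_mem _ hg)

theorem exists_isLcm_dvd {m : ℕ} (hs : X.Dvd r m) (ht : X.Dvd t m) :
    ∃ l, X.IsLcm r t l ∧ X.Dvd l m := by
  obtain ⟨l, hl, hlm, hmin⟩ :=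
    exists_minimal_dvd (X := X) {l | X.IsCommonMultiple r t l} ⟨hs, ht⟩
  exact ⟨l, ⟨hl, hmin⟩, hlm⟩

theorem IsSpoly.exists_isLM_up (hf : X.IsLM k f (.up t)) (h : X.IsSpoly k G f A) :
    ∀ g ∈ A, ∃ r, X.IsLM (k - 1) g (.up r) := by
  rcases h with ⟨r, hr, rfl⟩ | ⟨r, hr, g, -, p, hp, hdvd, rfl⟩ | ⟨r, hr, -, rfl⟩
  · rintro _ rfl
    exact ⟨r, hr⟩
  · rintro _ rfl
    obtain rfl := hf.eq_add_of_pred_down hr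
    exact ⟨_, isLM_scomb hf hr hp (Dvd.refl _) hdvd⟩
  · rintro _ ⟨g, -, p, l, hp, hl, rfl⟩
    obtain rfl := hf.eq_add_of_pred_down hr
    exact ⟨_, isLM_scomb hf hr hp hl.1.1 hl.1.2⟩

theorem IsSpoly.subset {s : ℤ} {M : Submodule X.R (X.R × X.R)} (hG : G ⊆ M) (hf : f ∈ M)
    (h : X.IsSpoly s G f A) : A ⊆ M := by
  rcases h with ⟨-, -, rfl⟩ | ⟨-, -, g, hg, -, -, -, rfl⟩ | ⟨-, -, -, rfl⟩
  · exact Set.singleton_subset_iff.2 hf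
  · exact Set.singleton_subset_iff.2 (scomb_mem hf (hG hg) _)
  · rintro _ ⟨g, hg, -, l, -, -, rfl⟩
    exact scomb_mem hf (hG hg) l

theorem exists_isSpoly (hf : X.IsLM k f (.up t)) (hG : ∀ g ∈ G, ∃ p, X.IsLM k g (.down p)) :
    ∃ A, X.IsSpoly k G f A := by
  rcases hf.pred_up with h | h
  · exact ⟨_, Or.inl ⟨t, h, rfl⟩⟩
  by_cases hdvd : Mono.down (t + k) ∈ X.DeltaGen₂ k G
  · exact ⟨_, Or.inr (Or.inr ⟨_, h, hdvd, rfl⟩)⟩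
  · obtain ⟨g, hg, m, hm, hdvd⟩ := (notMem_DeltaGen₂_iff h.idx_mem_S).1 hdvd
    obtain ⟨p, hp⟩ := hG g hg
    obtain rfl := hm.unique hp
    exact ⟨_, Or.inr (Or.inl ⟨_, h, g, hg, p, hp, hdvd, rfl⟩)⟩

theorem IsReduction.DeltaGen₂_subset {s : ℤ} {A' : Set (X.R × X.R)} (h : X.IsReduction s A A') :
    X.DeltaGen₂ s A' ⊆ X.DeltaGen₂ s A := by
  refine fun m hm => ⟨hm.1, fun f hf p hp hdvd => ?_⟩
  obtain ⟨g, hg, p', q, hp', hq, hqp⟩ := h.2.1 f hf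
  obtain rfl := hp'.unique hp
  exact hm.2 g hg q hq (hqp.trans hdvd)

theorem exists_isReduction {s : ℤ} (hA : ∀ f ∈ A, ∃ m, X.IsLM s f m) :
    ∃ A', X.IsReduction s A A' := by
  have : Nonempty Mono := ⟨.up 0⟩
  choose! lm hlm using hA
  set T := {m ∈ lm '' A | ∀ p ∈ lm '' A, X.MonoDvd p m → p = m}
  have hT : ∀ m ∈ T, ∃ f ∈ A, lm f = m := fun m hm => hm.1
  choose! rep hrepA hrep using hT
  refine ⟨rep '' T, ?_, fun f hf => ?_, ?_⟩
  · rintro _ ⟨m, hm, rfl⟩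
    exact hrepA m hm
  · obtain ⟨p, hp, hdvd, hmin⟩ := exists_minimal_monoDvd (X := X) (lm '' A) ⟨f, hf, rfl⟩
    have hpT : p ∈ T := ⟨hp, hmin⟩
    exact ⟨rep p, ⟨p, hpT, rfl⟩, lm f, lm (rep p), hlm f hf, hlm _ (hrepA p hpT),
      by rwa [hrep p hpT]⟩
  · rintro _ ⟨m, hm, rfl⟩ _ ⟨p, hp, rfl⟩ m' p' hm' hp' hdvd
    obtain rfl : m' = m := hrep m hm ▸ hm'.unique (hlm _ (hrepA m hm))
    obtain rfl : p' = p := hrep p hp ▸ hp'.unique (hlm _ (hrepA p hp))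
    rw [hm.2 p' hp.1 hdvd]

theorem exists_isUpdate (k : ℕ) (B : Set (X.R × X.R)) : ∃ B', X.IsUpdate k B B' := by
  have hspoly : ∀ f ∈ X.upPart k B, ∃ A, X.IsSpoly k (X.downPart k B) f A := by
    rintro f ⟨-, t, ht⟩
    exact exists_isSpoly ht fun g hg => hg.2
  choose! A hA using hspoly
  obtain ⟨B₁, h₁⟩ := exists_isReduction (X := X) (s := (k : ℤ) - 1)
    (A := X.downPart k B ∪ {f | f ∈ X.upPart k B ∧ ∃ t, X.IsLM ((k : ℤ) - 1) f (.down t) ∧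
      Mono.down t ∈ X.DeltaGen₂ k (X.downPart k B)}) (by
    rintro f (⟨-, t, ht⟩ | ⟨-, t, ht, -⟩)
    exacts [⟨_, ht.pred_down⟩, ⟨_, ht⟩])
  obtain ⟨B₂, h₂⟩ := exists_isReduction (X := X) (s := (k : ℤ) - 1)
    (A := ⋃ f ∈ X.upPart k B, A f) (by
    intro g hg
    obtain ⟨f, hf, hg⟩ := Set.mem_iUnion₂.1 hg
    obtain ⟨t, ht⟩ := hf.2
    obtain ⟨r, hr⟩ := (hA f hf).exists_isLM_up ht g hg
    exact ⟨_, hr⟩)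
  exact ⟨B₁ ∪ B₂, A, B₁, B₂, hA, h₁, h₂, rfl⟩

theorem IsUpdate.subset {s : ℤ} {M : Submodule X.R (X.R × X.R)} (h : X.IsUpdate s B B')
    (hB : B ⊆ M) : B' ⊆ M := by
  obtain ⟨A, B₁, B₂, hA, h₁, h₂, rfl⟩ := h
  refine Set.union_subset (h₁.1.trans ?_) (h₂.1.trans (Set.iUnion₂_subset fun f hf => ?_))
  · rintro g (hg | hg)
    exacts [hB hg.1, hB hg.1.1]
  · exact (hA f hf).subset (fun g hg => hB hg.1) (hB hf.1)

theorem IsUpdate.down_mem_DeltaGen₂ {s : ℤ} (h : X.IsUpdate s B B')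
    (ht : Mono.down t ∈ X.DeltaGen₂ (s - 1) B') : Mono.down t ∈ X.DeltaGen₂ s B := by
  obtain ⟨A, B₁, B₂, -, h₁, -, rfl⟩ := h
  have ht₁ := h₁.DeltaGen₂_subset (DeltaGen₂_antitone Set.subset_union_left ht)
  refine ⟨ht.1, fun f hf p hp hdvd => ?_⟩
  rcases p with p | p
  · exact hdvd
  · exact ht₁.2 f (Or.inl ⟨hf, p, hp⟩) _ hp.pred_down hdvd

theorem Dvd.sub_right {m : ℕ} (h : X.Dvd l (m + k)) (hk : k ≤ l) : X.Dvd (l - k) m := by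
  obtain ⟨q, hq, hlq⟩ := h
  exact ⟨q, hq, by omega⟩

theorem IsSpoly.down_add_mem_DeltaGen₂ {m : ℕ} (h : X.IsSpoly k (X.downPart k B) f A)
    (hf : X.IsLM k f (.up t)) (hdvd : X.Dvd t m)
    (hm : Mono.up m ∈ X.DeltaGen₂ (k - 1) A) :
    X.IsLM (k - 1) f (.down (t + k)) ∧ Mono.down (t + k) ∈ X.DeltaGen₂ k (X.downPart k B) ∧
      Mono.down (m + k) ∈ X.DeltaGen₂ k B := by
  have hdvd' : X.Dvd (t + k) (m + k) := hdvd.add_right k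
  rcases h with ⟨r, hr, rfl⟩ | ⟨r, hr, g, -, p, hp, hpt, rfl⟩ | ⟨r, hr, hnew, rfl⟩
  · rw [← (isLM_up.1 hf).1.unique (isLM_up.1 hr).1] at hr
    exact absurd hdvd (hm.2 f rfl _ hr)
  · obtain rfl := hf.eq_add_of_pred_down hr
    exact absurd (hdvd'.sub_right (Nat.le_add_left k t))
      (hm.2 _ rfl _ (isLM_scomb hf hr hp (Dvd.refl _) hpt))
  · obtain rfl := hf.eq_add_of_pred_down hr
    refine ⟨hr, hnew, hdvd'.mem_S hr.idx_mem_S, fun g hg p hp hpm => ?_⟩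
    rcases p with p | p
    · exact hpm
    obtain ⟨l, hl, hlm⟩ := exists_isLcm_dvd hdvd' hpm
    exact hm.2 _ ⟨g, ⟨hg, p, hp⟩, p, l, hp, hl, rfl⟩ _ (isLM_scomb hf hr hp hl.1.1 hl.1.2)
      (hlm.sub_right ((Nat.le_add_left k t).trans hl.1.1.le))

theorem IsUpdate.down_add_mem_DeltaGen₂_sdiff (h : X.IsUpdate k B B')
    (ht : Mono.up t ∈ X.DeltaGen₂ (k - 1) B' \ X.DeltaGen₂ k B) :
    Mono.down (t + k) ∈ X.DeltaGen₂ k B \ X.DeltaGen₂ (k - 1) B' := by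
  obtain ⟨A, B₁, B₂, hA, h₁, h₂, rfl⟩ := h
  obtain ⟨f, hf, p, hp, hdvd⟩ := (notMem_DeltaGen₂_iff ht.1.1).1 ht.2
  rcases p with p | p
  swap
  · exact hdvd.elim
  have hfup : f ∈ X.upPart k B := ⟨hf, p, hp⟩
  have htA : Mono.up t ∈ X.DeltaGen₂ (k - 1) (A f) :=
    DeltaGen₂_antitone (Set.subset_biUnion_of_mem hfup)
      (h₂.DeltaGen₂_subset (DeltaGen₂_antitone Set.subset_union_right ht.1))
  obtain ⟨hfdown, hnew, hmem⟩ := (hA f hfup).down_add_mem_DeltaGen₂ hp hdvd htA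
  refine ⟨hmem, fun hmem' => ?_⟩
  exact (h₁.DeltaGen₂_subset (DeltaGen₂_antitone Set.subset_union_left hmem')).2 f
    (Or.inr ⟨hfup, _, hfdown, hnew⟩) _ hfdown (Dvd.add_right hdvd k)

theorem IsUpdate.finite_and_ncard_DeltaGen₂_le (h : X.IsUpdate k B B')
    (hfin : (X.DeltaGen₂ k B).Finite) : (X.DeltaGen₂ (k - 1) B').Finite ∧
      (X.DeltaGen₂ (k - 1) B').ncard ≤ (X.DeltaGen₂ k B).ncard := by
  refine finite_and_ncard_le_of_injOn_sdiff hfin (fun m => .down (m.idx + k)) ?_ ?_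
  · rintro (t | t) ht
    · exact h.down_add_mem_DeltaGen₂_sdiff ht
    · exact absurd (h.down_mem_DeltaGen₂ ht.1) ht.2
  · rintro (t | t) ht (r | r) hr htr
    · exact congrArg Mono.up (Nat.add_right_cancel (Mono.down.inj htr))
    · exact absurd (h.down_mem_DeltaGen₂ hr.1) hr.2
    all_goals exact absurd (h.down_mem_DeltaGen₂ ht.1) ht.2

end Update

section Guess

/-! ### Step M1 -/

variable {n : ℕ} {P : Fin n ↪ X.Point} {f : X.R × X.R} {μ : X.R} {B : Set (X.R × X.R)}
  {e : Fin n → F} {k t : ℕ} {c w : F}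

theorem shift_eq (k : ℕ) (w : F) (f : X.R × X.R) :
    X.shift k w f = (f.1, f.2 + w • (X.phi k * f.1)) := by
  rw [shift, mul_assoc, const_mul]

theorem isLM_shift (hk : k ∈ X.S) (w : F) {m : Mono} (h : X.IsLM k f m) :
    X.IsLM k (X.shift k w f) m := by
  have hmul {N : ℤ} (hf : f.1 ∈ X.deltaLE N) : w • (X.phi k * f.1) ∈ X.deltaLE (k + N) :=
    Submodule.smul_mem _ _ (mul_mem_deltaLE (hasLead_phi hk).mem_deltaLE hf)
  rw [shift_eq]
  rcases m with t | t
  · rw [isLM_up] at h ⊢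
    exact ⟨h.1, add_mem h.2 (deltaLE_mono (by omega) (hmul h.1.mem_deltaLE))⟩
  · rw [isLM_down] at h ⊢
    exact ⟨h.1.add (deltaLE_mono (by omega) (hmul h.2)), h.2⟩

theorem DeltaGen₂_shift_subset (hk : k ∈ X.S) (w : F) (B : Set (X.R × X.R)) :
    X.DeltaGen₂ k (X.shift k w '' B) ⊆ X.DeltaGen₂ k B :=
  fun _ hm => ⟨hm.1, fun f hf p hp => hm.2 _ ⟨f, hf, rfl⟩ p (isLM_shift hk w hp)⟩

theorem shift_mem_interp (hf : f ∈ interp P (e + evalPi P (μ + w • X.phi k))) :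
    X.shift k w f ∈ interp P (e + evalPi P μ) := by
  rw [mem_interp] at hf ⊢
  rw [← hf, shift_eq]
  simp only [map_add, map_mul, Algebra.smul_def]
  ring

theorem add_mem_zeroIdeal (hf : f ∈ interp P (e + evalPi P μ)) :
    f.1 * μ + f.2 ∈ zeroIdeal P e := by
  refine mem_zeroIdeal.2 fun i hi => ?_
  have hfi : evalHom (P i) f.1 * (e i + evalHom (P i) μ) + evalHom (P i) f.2 = 0 :=
    congrFun (mem_interp.1 hf) i
  rw [map_add, map_mul, ← hfi, hi, zero_add]

theorem Delta_zeroIdeal_subset_preimage_down (hμ : μ ∈ X.deltaLE k)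
    (hB : B ⊆ interp P (e + evalPi P μ)) :
    X.Delta (zeroIdeal P e) ⊆ Mono.down ⁻¹' X.DeltaGen₂ k B := by
  refine fun t ht => ⟨ht.1, fun f hf p hp hdvd => ?_⟩
  obtain p | p := p
  · exact hdvd
  rw [isLM_down] at hp
  have hlead : X.HasLead (f.1 * μ + f.2) p := add_comm (f.1 * μ) f.2 ▸
    hp.1.add (deltaLE_mono (by omega) (mul_mem_deltaLE hp.2 hμ))
  exact ((mem_Delta_span_phi hlead.mem_S).1
    (Delta_subset_Delta_span_phi (add_mem_zeroIdeal (hB hf)) hlead ht)).2 hdvd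

theorem vote_eq (hk : k ∈ X.S) (hf : X.HasLead f.1 t) :
    X.vote k f = -(X.coeff f.2 (t + k) / X.coeff (f.1 * X.phi k) (t + k)) := by
  rw [vote, lc, (hf.mul (hasLead_phi hk)).delta_eq]

theorem hasLead_mul_add_of_vote_ne (hk : k ∈ X.S) (hμ : μ ∈ X.deltaLE (k - 1))
    (hf : X.IsLM k f (.up t)) (hw : X.vote k f ≠ w) :
    X.HasLead (f.1 * (μ + w • X.phi k) + f.2) (t + k) := by
  rw [isLM_up] at hf
  have hlead := hf.1.mul (hasLead_phi hk)
  have hlow : f.1 * μ ∈ X.deltaLE ((t + k : ℕ) - 1) :=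
    deltaLE_mono (by push_cast; omega) (mul_mem_deltaLE hf.1.mem_deltaLE hμ)
  have hcoeff : w * X.coeff (f.1 * X.phi k) (t + k) + X.coeff f.2 (t + k) ≠ 0 := by
    contrapose! hw
    rw [vote_eq hk hf.1, ← neg_div, div_eq_iff hlead.coeff_ne_zero]
    exact (eq_neg_of_add_eq_zero_left hw).symm
  have htop : X.HasLead (w • (f.1 * X.phi k) + f.2) (t + k) :=
    ⟨hlead.mem_S, by rwa [coeff_add, coeff_smul],
      add_mem (Submodule.smul_mem _ _ hlead.mem_deltaLE) (by exact_mod_cast hf.2)⟩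
  rw [mul_add, mul_smul_comm, add_assoc, add_comm]
  exact htop.add hlow

theorem not_dvd_of_vote_ne (hk : k ∈ X.S) (hμ : μ ∈ X.deltaLE (k - 1))
    (hf : f ∈ interp P (e + evalPi P (μ + w • X.phi k))) (hlm : X.IsLM k f (.up t))
    (hw : X.vote k f ≠ w) {r : ℕ} (hr : r ∈ X.Delta (zeroIdeal P e)) : ¬ X.Dvd (t + k) r := by
  have hlead := hasLead_mul_add_of_vote_ne hk hμ hlm hw
  exact ((mem_Delta_span_phi hlead.mem_S).1
    (Delta_subset_Delta_span_phi (add_mem_zeroIdeal hf) hlead hr)).2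

variable (X) in
/-- The set of monomials counted by `d_c`: the monomials of `Δ({G_i^D})` divisible by
`lm(F_j^U φ_k)` for some `j` with `w_j = c`. -/
def votes (k : ℕ) (B : Set (X.R × X.R)) (c : F) : Set ℕ :=
  {r | Mono.down r ∈ X.DeltaGen₂ k B ∧
    ∃ f ∈ B, ∃ t, X.IsLM k f (.up t) ∧ X.vote k f = c ∧ X.Dvd (t + k) r}

theorem mem_sigmaGen_mul_phi (hk : k ∈ X.S) {g : X.R} (hg : X.HasLead g t) {r : ℕ} :
    r ∈ X.sigmaGen {g * X.phi k} ↔ X.Dvd (t + k) r := by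
  have hlead := hg.mul (hasLead_phi hk)
  simp only [sigmaGen, Set.mem_singleton_iff, exists_eq_left, Set.mem_ofPred_eq, ne_eq,
    hlead.ne_zero, not_false_eq_true, hlead.delta_eq, true_and]

theorem dc_eq_ncard_votes (hk : k ∈ X.S) : X.dc k B c = (X.votes k B c).ncard := by
  rw [dc, DeltaGen_image_snd_downPart]
  congr 1
  ext r
  simp only [Set.mem_iUnion, votes, upPart, Set.mem_ofPred_eq, Set.mem_inter_iff, Set.mem_preimage]
  constructor
  · rintro ⟨f, ⟨⟨hf, t, hlm⟩, hc⟩, hdvd, hr⟩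
    exact ⟨hr, f, hf, t, hlm, hc, (mem_sigmaGen_mul_phi hk (isLM_up.1 hlm).1).1 hdvd⟩
  · rintro ⟨hr, f, hf, t, hlm, hc, hdvd⟩
    exact ⟨f, ⟨⟨hf, t, hlm⟩, hc⟩, (mem_sigmaGen_mul_phi hk (isLM_up.1 hlm).1).2 hdvd, hr⟩

theorem mem_W_of_votes_nonempty (h : (X.votes k B c).Nonempty) : c ∈ X.W k B := by
  obtain ⟨_, -, f, hf, t, hlm, hc, -⟩ := h
  exact ⟨f, ⟨hf, t, hlm⟩, hc⟩

theorem votes_subset_sdiff_Delta_zeroIdeal (hk : k ∈ X.S) (hμ : μ ∈ X.deltaLE (k - 1))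
    (hB : B ⊆ interp P (e + evalPi P (μ + w • X.phi k))) (hc : c ≠ w) :
    X.votes k B c ⊆ Mono.down ⁻¹' X.DeltaGen₂ k B \ X.Delta (zeroIdeal P e) := by
  rintro r ⟨hr, f, hf, t, hlm, rfl, hdvd⟩
  exact ⟨hr, fun hrΔ => not_dvd_of_vote_ne hk hμ (hB hf) hlm hc hrΔ hdvd⟩

theorem preimage_down_DeltaGen₂_interp_subset (r : Fin n → F) :
    Mono.down ⁻¹' X.DeltaGen₂ k (interp P r) ⊆ X.Delta (X.J P) := by
  refine fun t ht => ⟨ht.1, fun hσ => ?_⟩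
  obtain ⟨f, hf, hlead⟩ := mem_sigma.1 hσ
  have hmem : ((0 : X.R), f) ∈ interp P r :=
    mem_interp.2 (by rw [map_zero, zero_mul, zero_add]; exact funext (mem_vanishing.1 hf))
  exact (isLM_down.2 ⟨hlead, zero_mem _⟩ : X.IsLM k (0, f) (.down t)).notMem_DeltaGen₂ hmem ht

theorem preimage_down_DeltaGen₂_subset_union (hk : k ∈ X.S) (hμ : μ ∈ X.deltaLE (k - 1))
    (hB : B ⊆ interp P (e + evalPi P (μ + w • X.phi k)))
    (hJ : Mono.down ⁻¹' X.DeltaGen₂ k B ⊆ X.Delta (X.J P)) :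
    Mono.down ⁻¹' X.DeltaGen₂ k B ⊆
      X.votes k B w ∪ (Mono.down ⁻¹' X.DeltaGen₂ k B \ X.Delta (zeroIdeal P e)) ∪
        (X.Delta (X.J P) ∩ X.Delta (Ideal.span {X.phi k})) ∪
          (· + k) '' (Mono.up ⁻¹' X.DeltaGen₂ k B) := by
  intro r hr
  by_cases hkr : X.Dvd k r
  · obtain ⟨q, hq, rfl⟩ := hkr
    by_cases hqU : Mono.up q ∈ X.DeltaGen₂ k B
    · exact Or.inr ⟨q, hqU, add_comm q k⟩
    obtain ⟨f, hf, t | t, hlm, hdvd⟩ := (notMem_DeltaGen₂_iff hq).1 hqU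
    · have hdvd' : X.Dvd (t + k) (k + q) := add_comm q k ▸ Dvd.add_right hdvd k
      by_cases hw : X.vote k f = w
      · exact Or.inl (Or.inl (Or.inl ⟨hr, f, hf, t, hlm, hw, hdvd'⟩))
      · exact Or.inl (Or.inl (Or.inr
          ⟨hr, fun hrΔ => not_dvd_of_vote_ne hk hμ (hB hf) hlm hw hrΔ hdvd'⟩))
    · exact hdvd.elim
  · exact Or.inl (Or.inr ⟨hJ hr, (mem_Delta_span_phi hk).2 ⟨hr.1, hkr⟩⟩)

/-- Counting the cover of `Δ({G_i^D})` by the votes for `w`, the monomials outside `Δ(zeroIdeal)`,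
`Δ(J) ∩ Δ(R φ_k)`, and the translate of the footprint in `R z`; the two footprints have `n` elements
together. -/
theorem ncard_sdiff_Delta_zeroIdeal_lt_ncard_votes [DecidableEq F] (hk : k ∈ X.S)
    (hμ : μ ∈ X.deltaLE (k - 1)) (he : 2 * (hammingNorm e : ℤ) < X.nu P k)
    (hB : B ⊆ interp P (e + evalPi P (μ + w • X.phi k))) (hfin : (X.DeltaGen₂ k B).Finite)
    (hcard : (X.DeltaGen₂ k B).ncard ≤ n) :
    (Mono.down ⁻¹' X.DeltaGen₂ k B \ X.Delta (zeroIdeal P e)).ncard < (X.votes k B w).ncard := by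
  have hgroebner := DeltaGen₂_eq_DeltaGen₂_interp hB hfin hcard
  have hcover := preimage_down_DeltaGen₂_subset_union hk hμ hB
    (hgroebner ▸ preimage_down_DeltaGen₂_interp_subset _)
  have hsplit := Mono.ncard_eq_ncard_preimage_up_add hfin
  rw [hgroebner, ncard_DeltaGen₂_interp, ← hgroebner] at hsplit
  have hzero : X.Delta (zeroIdeal P e) ⊆ Mono.down ⁻¹' X.DeltaGen₂ k B :=
    Delta_zeroIdeal_subset_preimage_down (add_mem (deltaLE_mono (by omega) hμ)
      (Submodule.smul_mem _ _ (hasLead_phi hk).mem_deltaLE)) hB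
  have hUfin : (Mono.up ⁻¹' X.DeltaGen₂ k B).Finite := hfin.preimage (by simp [Set.InjOn])
  have hDfin : (Mono.down ⁻¹' X.DeltaGen₂ k B).Finite := hfin.preimage (by simp [Set.InjOn])
  have herror := ncard_Delta_zeroIdeal_add_hammingNorm (P := P) e
  have hnu := nu_add_ncard_inter_le P hk
  have hsdiff := Set.ncard_sdiff_add_ncard_of_subset hzero hDfin
  have hVfin : (X.votes k B w).Finite := hDfin.subset fun _ hr => hr.1
  have hJfin := (finite_Delta_J P).inter_of_left (X.Delta (Ideal.span {X.phi k}))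
  have hle := (Set.ncard_le_ncard hcover
    (((hVfin.union hDfin.sdiff).union hJfin).union (hUfin.image _))).trans (Set.ncard_union_le _ _)
  have hle₃ := Set.ncard_union_le
    (X.votes k B w ∪ (Mono.down ⁻¹' X.DeltaGen₂ k B \ X.Delta (zeroIdeal P e)))
    (X.Delta (X.J P) ∩ X.Delta (Ideal.span {X.phi k}))
  have hle₂ := Set.ncard_union_le (X.votes k B w)
    (Mono.down ⁻¹' X.DeltaGen₂ k B \ X.Delta (zeroIdeal P e))
  have himage := Set.ncard_image_le (f := (· + k)) hUfin
  omega

theorem isGuess_iff [DecidableEq F] (hk : k ∈ X.S)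
    (hμ : μ ∈ X.deltaLE (k - 1)) (he : 2 * (hammingNorm e : ℤ) < X.nu P k)
    (hB : B ⊆ interp P (e + evalPi P (μ + w • X.phi k))) (hfin : (X.DeltaGen₂ k B).Finite)
    (hcard : (X.DeltaGen₂ k B).ncard ≤ n) : X.IsGuess k B c ↔ c = w := by
  have hlt := ncard_sdiff_Delta_zeroIdeal_lt_ncard_votes hk hμ he hB hfin hcard
  have hDfin : (Mono.down ⁻¹' X.DeltaGen₂ k B).Finite := hfin.preimage (by simp [Set.InjOn])
  have hmajority : ∀ c, c ≠ w → X.dc k B c < X.dc k B w := fun c hc => by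
    rw [dc_eq_ncard_votes hk, dc_eq_ncard_votes hk]
    exact (Set.ncard_le_ncard (votes_subset_sdiff_Delta_zeroIdeal hk hμ hB hc)
      hDfin.sdiff).trans_lt hlt
  have hw : w ∈ X.W k B :=
    mem_W_of_votes_nonempty (Set.nonempty_of_ncard_ne_zero (Nat.ne_zero_of_lt hlt))
  constructor
  · rintro ⟨-, hmax⟩
    by_contra hc
    exact (hmajority c hc).not_ge (hmax w hw)
  · rintro rfl
    exact ⟨hw, fun c' _ => by
      obtain rfl | hc' := eq_or_ne c' c
      exacts [le_rfl, (hmajority c' hc').le]⟩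

end Guess

section Decoding

/-! ### Truncated messages -/

variable {n : ℕ} {P : Fin n ↪ X.Point} {e v : Fin n → F} {u k : ℕ} {ω : ℕ → F} {s : ℤ}

theorem coeff_message (ω : ℕ → F) {t : ℕ} (ht : t ∈ X.S) :
    X.coeff (X.message u ω) t = if t ≤ u then ω t else 0 := by
  have hterm : ∀ s ∈ X.nongapsLE u,
      X.coeff (X.const (ω s) * X.phi s) t = if s = t then ω s else 0 := fun s hs => by
    rw [const_mul, coeff_smul, coeff_phi (mem_nongapsLE.1 hs).1 ht, mul_ite, mul_one, mul_zero]
  rw [message, coeff_sum, Finset.sum_congr rfl hterm, Finset.sum_ite_eq']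
  exact if_congr (mem_nongapsLE.trans (and_iff_right ht)) rfl rfl

theorem message_mem_deltaLE (u : ℕ) (ω : ℕ → F) : X.message u ω ∈ X.deltaLE u :=
  mem_deltaLE.2 fun t ht hne => by
    rw [coeff_message ω ht, ite_ne_right_iff] at hne
    exact_mod_cast hne.1

variable (X) in
/-- The part of the message function with monomials `φ_t`, `t ≤ s`, which is still unknown before
the iteration `s`. -/
def truncMessage (u : ℕ) (ω : ℕ → F) (s : ℤ) : X.R :=
  X.message u fun t => if (t : ℤ) ≤ s then ω t else 0

theorem truncMessage_mem_deltaLE (u : ℕ) (ω : ℕ → F) (s : ℤ) :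
    X.truncMessage u ω s ∈ X.deltaLE s :=
  mem_deltaLE.2 fun t ht hne => by
    rw [truncMessage, coeff_message _ ht, ite_ne_right_iff, ite_ne_right_iff] at hne
    exact hne.2.1

theorem truncMessage_eq_message (h : ∀ t ∈ X.S, t ≤ u → s < t → ω t = 0) :
    X.truncMessage u ω s = X.message u ω := by
  refine ext_coeff fun t ht => ?_
  rw [truncMessage, coeff_message _ ht, coeff_message _ ht]
  grind

theorem truncMessage_eq_add (ω : ℕ → F) (hk : k ∈ X.S) (hku : k ≤ u) :
    X.truncMessage u ω k = X.truncMessage u ω (k - 1) + ω k • X.phi k := by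
  refine ext_coeff fun t ht => ?_
  rw [coeff_add, coeff_smul, coeff_phi hk ht, truncMessage, truncMessage, coeff_message _ ht,
    coeff_message _ ht]
  grind

theorem truncMessage_sub_one (ω : ℕ → F) (hk : ¬ (k ∈ X.S ∧ k ≤ u)) :
    X.truncMessage u ω (k - 1) = X.truncMessage u ω k := by
  refine ext_coeff fun t ht => ?_
  rw [truncMessage, truncMessage, coeff_message _ ht, coeff_message _ ht]
  grind

/-! ### The invariant of the algorithm -/

variable (P) in
/-- The properties of the states that the algorithm passes through: the basis lies in the
interpolation module of the error plus the part of the message that is still unknown, its footprint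
has at most `n` elements (so that it is a Gröbner basis), and all guesses so far are correct. -/
structure Invariant (u : ℕ) (ω : ℕ → F) (e : Fin n → F) (σ : X.State) : Prop where
  subset : σ.B ⊆ interp P (e + evalPi P (X.truncMessage u ω σ.s))
  finite : (X.DeltaGen₂ σ.s σ.B).Finite
  ncard_le : (X.DeltaGen₂ σ.s σ.B).ncard ≤ n
  guess : ∀ t ∈ X.S, t ≤ u → σ.s < t → σ.w t = ω t

/-- Otherwise `μ - h`, which takes the values `-e`, would have its leading monomial among those of
`μ`, and thus at least `d_u` nonzero values. -/
theorem message_mem_deltaLE_of_ev_eq [DecidableEq F] {h : X.R}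
    (he : 2 * (hammingNorm e : ℤ) < X.du P u) (hh : X.ev P h = X.ev P (X.message u ω) + e)
    (hs : h ∈ X.deltaLE s) : X.message u ω ∈ X.deltaLE s := by
  refine mem_deltaLE.2 fun t ht hne => ?_
  by_contra! hst
  set μ := X.message u ω
  have hμ : X.HasLead μ (X.delta μ) :=
    hasLead_delta fun h0 => hne (by rw [h0, coeff_zero])
  have hle : (t : ℤ) ≤ X.delta μ := mem_deltaLE.1 hμ.mem_deltaLE t ht hne
  have hdelta : ((X.delta μ : ℕ) : ℤ) ≤ u :=
    mem_deltaLE.1 (message_mem_deltaLE u ω) _ hμ.mem_S hμ.coeff_ne_zero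
  have hev : X.ev P (μ - h) = -e := by
    have hsub : X.ev P (μ - h) = X.ev P μ - X.ev P h := map_sub (evalPi P) μ h
    rw [hsub, hh, sub_add_cancel_left]
  have hnu := nu_le_hammingNorm_ev (P := P) (hμ.sub (deltaLE_mono (by omega) hs))
  have hdu := du_le_nu P hμ.mem_S (by exact_mod_cast hdelta)
  have hnorm : hammingNorm (-e) = hammingNorm e := by simp [hammingNorm]
  rw [hev, hnorm] at hnu
  omega

theorem hasLead_one : X.HasLead 1 0 := by
  simpa using hasLead_x_pow_mul_y_pow (X := X) 0 0

theorem DeltaGen₂_init_subset {h : X.R} {η : Set X.R} (hs : h ∈ X.deltaLE s)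
    (hη : X.IsGroebnerBasis (X.J P) η) :
    X.DeltaGen₂ s ((fun g => ((0 : X.R), g)) '' η ∪ {((1 : X.R), -h)}) ⊆
      Mono.down '' X.Delta (X.J P) := by
  rintro (t | t) ⟨ht, hm⟩
  · have hlm : X.IsLM s (1, -h) (.up 0) :=
      isLM_up.2 ⟨hasLead_one, neg_mem (deltaLE_mono (by simp) hs)⟩
    exact (hm _ (Or.inr rfl) _ hlm ⟨t, ht, (zero_add t).symm⟩).elim
  · refine ⟨t, ⟨ht, ?_⟩, rfl⟩
    rintro ⟨f, hf, h0, rfl⟩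
    obtain ⟨g, hg, hdvd⟩ := hη.2 f hf h0
    have hlm : X.IsLM s (0, g) (.down (X.delta g)) :=
      isLM_down.2 ⟨hasLead_delta (hη.1 g hg).2, zero_mem _⟩
    exact hm _ (Or.inl ⟨g, hg, rfl⟩) _ hlm hdvd

theorem init_subset_interp {h : X.R} {η : Set X.R} (hη : X.IsGroebnerBasis (X.J P) η) :
    (fun g => ((0 : X.R), g)) '' η ∪ {((1 : X.R), -h)} ⊆
      (interp P (evalPi P h) : Set (X.R × X.R)) := by
  rintro _ (⟨g, hg, rfl⟩ | rfl)
  · refine mem_interp.2 ?_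
    rw [map_zero, zero_mul, zero_add]
    exact funext (mem_vanishing.1 (hη.1 g hg).1)
  · exact mem_interp.2 (by rw [map_one, one_mul, map_neg, add_neg_cancel])

theorem Invariant.of_isInit [DecidableEq F] (hv : v = X.ev P (X.message u ω) + e)
    (he : 2 * (hammingNorm e : ℤ) < X.du P u) {σ : X.State} (hσ : X.IsInit P v σ) :
    Invariant P u ω e σ := by
  obtain ⟨h, η, hh, -, hη, hB, hs, hw⟩ := hσ
  have hlow : h ∈ X.deltaLE σ.s := by
    rcases hs with ⟨rfl, -⟩ | ⟨h0, hs⟩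
    · exact zero_mem _
    · exact hs ▸ (hasLead_delta h0).mem_deltaLE
  have hω : ∀ t ∈ X.S, t ≤ u → σ.s < t → ω t = 0 := fun t ht htu hst => by
    have hcoeff := coeff_eq_zero_of_mem_deltaLE
      (message_mem_deltaLE_of_ev_eq he (hh.trans hv) hlow) ht hst
    rwa [coeff_message ω ht, if_pos htu] at hcoeff
  have hsubset := hB ▸ DeltaGen₂_init_subset hlow hη
  have hfin := (finite_Delta_J P).image Mono.down
  have hvalues : evalPi P h = e + evalPi P (X.message u ω) := (hh.trans hv).trans (add_comm _ _)
  refine ⟨?_, hfin.subset hsubset, ?_, fun t ht htu hst => ?_⟩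
  · rw [truncMessage_eq_message hω, ← hvalues, hB]
    exact init_subset_interp hη
  · exact ((Set.ncard_le_ncard hsubset hfin).trans (Set.ncard_image_le (finite_Delta_J P))).trans_eq
      (ncard_Delta_J P)
  · rw [hw, hω t ht htu hst, Pi.zero_apply]

theorem Invariant.isGuess_iff [DecidableEq F] {c : F} (he : 2 * (hammingNorm e : ℤ) < X.du P u)
    {σ : X.State} (h : Invariant P u ω e σ) (hs : σ.s = k) (hk : k ∈ X.S) (hku : k ≤ u) :
    X.IsGuess k σ.B c ↔ c = ω k := by
  obtain ⟨hB, hfin, hcard, -⟩ := h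
  rw [hs] at hB hfin hcard
  rw [truncMessage_eq_add ω hk hku] at hB
  exact MiuraKamiyaCurve.isGuess_iff hk (truncMessage_mem_deltaLE u ω _)
    (he.trans_le (du_le_nu P hk hku)) hB hfin hcard

theorem Invariant.exists_step [DecidableEq F] (he : 2 * (hammingNorm e : ℤ) < X.du P u)
    {σ : X.State} (h : Invariant P u ω e σ) (hs : 0 ≤ σ.s) : ∃ σ', X.Step u σ σ' := by
  obtain ⟨k, hk⟩ := Int.eq_ofNat_of_zero_le hs
  by_cases hkS : k ∈ X.S ∧ k ≤ u
  · obtain ⟨B', hB'⟩ := exists_isUpdate k (X.shift k (ω k) '' σ.B)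
    exact ⟨⟨k - 1, B', Function.update σ.w k (ω k)⟩, k, _, hk, rfl,
      Or.inl ⟨hkS.1, hkS.2, ω k, (h.isGuess_iff he hk hkS.1 hkS.2).2 rfl, rfl, rfl⟩, hB'⟩
  · obtain ⟨B', hB'⟩ := exists_isUpdate k σ.B
    exact ⟨⟨k - 1, B', σ.w⟩, k, _, hk, rfl, Or.inr ⟨hkS, rfl, rfl⟩, hB'⟩

theorem Invariant.of_isUpdate {σ σ' : X.State} (h : Invariant P u ω e σ) (hs : σ.s = k)
    (hs' : σ'.s = k - 1) {B : Set (X.R × X.R)} (hupdate : X.IsUpdate k B σ'.B)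
    (hB : B ⊆ interp P (e + evalPi P (X.truncMessage u ω (k - 1))))
    (hsubset : X.DeltaGen₂ k B ⊆ X.DeltaGen₂ k σ.B)
    (hguess : ∀ t ∈ X.S, t ≤ u → (k : ℤ) - 1 < t → σ'.w t = ω t) : Invariant P u ω e σ' := by
  obtain ⟨-, hfin, hcard, -⟩ := h
  rw [hs] at hfin hcard
  obtain ⟨hfin', hle⟩ := hupdate.finite_and_ncard_DeltaGen₂_le (hfin.subset hsubset)
  have hcard' := (hle.trans (Set.ncard_le_ncard hsubset hfin)).trans hcard
  rw [← hs'] at hB hfin' hcard' hguess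
  exact ⟨hupdate.subset hB, hfin', hcard', hguess⟩

theorem Invariant.step [DecidableEq F] (he : 2 * (hammingNorm e : ℤ) < X.du P u)
    {σ σ' : X.State} (h : Invariant P u ω e σ) (hstep : X.Step u σ σ') : Invariant P u ω e σ' := by
  obtain ⟨k, B, hs, hs', hcase, hupdate⟩ := hstep
  have hB := h.subset
  have hguess := h.guess
  rw [hs] at hB hguess
  rcases hcase with ⟨hk, hku, c, hc, rfl, hw⟩ | ⟨hk, rfl, hw⟩
  · obtain rfl := (h.isGuess_iff he hs hk hku).1 hc
    rw [truncMessage_eq_add ω hk hku] at hB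
    refine h.of_isUpdate hs hs' hupdate
      (Set.image_subset_iff.2 fun f hf => shift_mem_interp (hB hf))
      (DeltaGen₂_shift_subset hk _ _) fun t ht htu hlt => ?_
    rw [hw]
    obtain rfl | htk := eq_or_ne t k
    · rw [Function.update_self]
    · rw [Function.update_of_ne htk]
      exact hguess t ht htu (by omega)
  · rw [← truncMessage_sub_one ω hk] at hB
    refine h.of_isUpdate hs hs' hupdate hB subset_rfl fun t ht htu hlt => ?_
    have htk : t ≠ k := fun htk => hk ⟨htk ▸ ht, htk ▸ htu⟩
    rw [hw]
    exact hguess t ht htu (by omega)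

theorem Invariant.of_reflTransGen [DecidableEq F] (he : 2 * (hammingNorm e : ℤ) < X.du P u)
    {σ σ' : X.State} (h : Invariant P u ω e σ) (hσ : Relation.ReflTransGen (X.Step u) σ σ') :
    Invariant P u ω e σ' := by
  induction hσ with
  | refl => exact h
  | tail _ hstep ih => exact ih.step he hstep

end Decoding

end MiuraKamiyaCurve

end

theorem mainTheorem1_general {F : Type*} [Field F] [DecidableEq F] (X : MiuraKamiyaCurve F)
    {n : ℕ} (P : Fin n ↪ X.Point) (u : ℕ) :
    (n : ℤ) - u ≤ X.du P u ∧
    ∀ (ω : ℕ → F) (e v : Fin n → F), v = X.ev P (X.message u ω) + e →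
      2 * (hammingNorm e : ℤ) < X.du P u →
      (∃ σ, X.IsInit P v σ) ∧
      ∀ σ₀, X.IsInit P v σ₀ → ∀ σ, Relation.ReflTransGen (X.Step u) σ₀ σ →
        (0 ≤ σ.s → ∃ σ', X.Step u σ σ') ∧
        (σ.s < 0 → ∀ s ∈ X.S, s ≤ u → σ.w s = ω s) := by
  refine ⟨MiuraKamiyaCurve.sub_le_du P u, fun ω e v hv he =>
    ⟨MiuraKamiyaCurve.exists_isInit v, fun σ₀ h₀ σ hσ => ?_⟩⟩
  have hinv : MiuraKamiyaCurve.Invariant P u ω e σ :=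
    (MiuraKamiyaCurve.Invariant.of_isInit hv he h₀).of_reflTransGen he hσ
  exact ⟨hinv.exists_step he, fun hs t ht htu => hinv.guess t ht htu (by omega)⟩

theorem mainTheorem1 {F : Type*} [Field F] [DecidableEq F] (X : MiuraKamiyaCurve F)
    {n : ℕ} (P : Fin n ↪ X.Point) (u : ℕ) (hu : u < n) :
    (n : ℤ) - u ≤ X.du P u ∧
    ∀ (ω : ℕ → F) (e v : Fin n → F), v = X.ev P (X.message u ω) + e →
      2 * (hammingNorm e : ℤ) < X.du P u →
      (∃ σ, X.IsInit P v σ) ∧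
      ∀ σ₀, X.IsInit P v σ₀ → ∀ σ, Relation.ReflTransGen (X.Step u) σ₀ σ →
        (0 ≤ σ.s → ∃ σ', X.Step u σ σ') ∧
        (σ.s < 0 → ∀ s ∈ X.S, s ≤ u → σ.w s = ω s) :=
  mainTheorem1_general X P u
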